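/- Consider the class of equations $$u_t+u^nu_x+h(t)u=g(t)u_{xx},\qquad u>0, \qquad (1)$$ where $h$ and $g$ are smooth real functions on an open interval, $g$ vanishes nowhere, and $n$ is a nonzero real constant; $h$, $g$ and $n$ are the arbitrary elements of the class. A point transformation $\tilde t=T(t,x,u)$, $\tilde x=X(t,x,u)$, $\tilde u=U(t,x,u)$ is smooth with nonvanishing Jacobian on a connected open set, on which $u>0$ and $\tilde u>0$. An admissible transformation is a point transformation together with a source and a target equation of the class such that the transformation maps the first equation to the second (in the second-order jet space). The generalized equivalence group $\hat G^\sim$ consists of the (local) point transformations of the joint space of $(t,x,u,h,g,n)$, considered on convex open sets where $u>0$, $g\ne0$, $n\ne0$, that become, once the arbitrary elements of any equation of the class are inserted, point transformations of $(t,x,u)$ mapping this equation to the equation of the class whose arbitrary elements are the transformed ones. **Theorem.** The generalized equivalence group $\hat G^\sim$ of the class (1) consists of the transformations $$\tilde t=T(t),\quad \tilde x=\delta_1x+\delta_0,\quad \tilde u=\Bigl(\frac{\delta_1}{T_t}\Bigr)^{1/n}u,\quad \tilde h=\frac{h}{T_t}+\frac{T_{tt}}{nT_t^{2}},\quad \tilde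 g=\frac{\delta_1^{2}}{T_t}\,g,\quad \tilde n=n,$$ where $\delta_1$, $\delta_0$ are arbitrary constants and $T=T(t)$ is an arbitrary smooth function with $\delta_1T_t>0$; here $\delta_1$, $\delta_0$ and $T$ may moreover depend smoothly on the constant arbitrary element $n$. Every admissible transformation in the subclass of (1) singled out by $n\ne1$ is induced by an element of $\hat G^\sim$, and even by one with $\delta_1$, $\delta_0$, $T$ independent of $n$. Thus the equivalence groupoid of this subclass is generated by $\hat G^\sim$, and the subclass is normalized in the generalized sense, i.e. each of its admissible transformations is induced by an element of its own generalized equivalence group. -/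

import Mathlib

open Set Topology
open scoped ContDiff

/-- The space of the variables `(t, x, u)`. -/
abbrev VarSpace : Type := ℝ × ℝ × ℝ

/-- The space of the values `(h, g, n)` of the arbitrary elements. -/
abbrev ElemSpace : Type := ℝ × ℝ × ℝ

/-- The joint space of the variables and the arbitrary elements, `((t, x, u), (h, g, n))`. -/
abbrev JointSpace : Type := VarSpace × ElemSpace

/-- An equation `u_t + u ^ n u_x + h(t) u = g(t) u_xx` of the class: smooth coefficients `h` and
`g ≠ 0` on an open interval `I` of values of `t`, and a constant `n ≠ 0`. The values of `h` and `g`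
outside `I` play no role. -/
structure GenBurgers where
  /-- the interval of values of `t` -/
  I : Set ℝ
  /-- the damping coefficient -/
  h : ℝ → ℝ
  /-- the viscosity coefficient -/
  g : ℝ → ℝ
  /-- the exponent -/
  n : ℝ
  isOpen_I : IsOpen I
  isConnected_I : IsConnected I
  smooth_h : ContDiffOn ℝ ∞ h I
  smooth_g : ContDiffOn ℝ ∞ g I
  g_ne_zero : ∀ t ∈ I, g t ≠ 0
  n_ne_zero : n ≠ 0

namespace GenBurgers

/-- The values of the arbitrary elements of the equation at `t`. -/
def val (θ : GenBurgers) (t : ℝ) : ElemSpace := (θ.h t, θ.g t, θ.n)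

/-- The part of the space of variables where the equation is considered: `t ∈ I` and `u > 0`
(real powers of `u` are used, and the exponent varies in the class). -/
def base (θ : GenBurgers) : Set VarSpace := {z | z.1 ∈ θ.I ∧ 0 < z.2.2}

/-- The function `u` of `(t, x)` satisfies the equation at the point `q = (t, x)`; this is a
condition on the second-order jet of `u` at `q`. -/
def HoldsAt (θ : GenBurgers) (u : ℝ × ℝ → ℝ) (q : ℝ × ℝ) : Prop :=
  deriv (fun s => u (s, q.2)) q.1 + u q ^ θ.n * deriv (fun y => u (q.1, y)) q.2 + θ.h q.1 * u q
    = θ.g q.1 * deriv (deriv (fun y => u (q.1, y))) q.2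

end GenBurgers

/-- `φ = (T, X, U)` is a point transformation on the domain `D`: it is smooth there and its
Jacobian `∂(T,X,U)/∂(t,x,u)` does not vanish. -/
structure IsPointTransformation (φ : VarSpace → VarSpace) (D : Set VarSpace) : Prop where
  isOpen : IsOpen D
  isConnected : IsConnected D
  smooth : ContDiffOn ℝ ∞ φ D
  jacobian_ne_zero : ∀ z ∈ D, (fderiv ℝ φ z).det ≠ 0

/-- The map `(t, x) ↦ (T(t, x, u(t, x)), X(t, x, u(t, x)))` of the independent variables. -/
def baseMap (φ : VarSpace → VarSpace) (u : ℝ × ℝ → ℝ) (q : ℝ × ℝ) : ℝ × ℝ :=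
  ((φ (q.1, q.2, u q)).1, (φ (q.1, q.2, u q)).2.1)

/-- Near the point `q`, the transformation `φ` maps the graph of the smooth function `u` to
the graph of the smooth function `v`. -/
structure MapsGraphAt (φ : VarSpace → VarSpace) (u v : ℝ × ℝ → ℝ) (q : ℝ × ℝ) : Prop where
  smooth_source : ContDiffAt ℝ ∞ u q
  smooth_target : ContDiffAt ℝ ∞ v (baseMap φ u q)
  transversal : (fderiv ℝ (baseMap φ u) q).det ≠ 0
  graph : ∀ᶠ p in 𝓝 q, v (baseMap φ u p) = (φ (p.1, p.2, u p)).2.2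

/-- The point transformation `φ` on `D` maps the equation `θ` to the equation `θ'`: its
second-order prolongation identifies the submanifolds of the jet space that the two equations
define. The jets are represented by functions. -/
structure MapsEquation (θ θ' : GenBurgers) (φ : VarSpace → VarSpace) (D : Set VarSpace) :
    Prop where
  isPoint : IsPointTransformation φ D
  source : D ⊆ θ.base
  target : MapsTo φ D θ'.base
  maps : ∀ (u v : ℝ × ℝ → ℝ) (q : ℝ × ℝ), (q.1, q.2, u q) ∈ D → MapsGraphAt φ u v q →
    (θ.HoldsAt u q ↔ θ'.HoldsAt v (baseMap φ u q))

/-- An admissible transformation in the class `K` (an element of its equivalence groupoid). -/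
def IsAdmissible (K : Set GenBurgers) (θ θ' : GenBurgers) (φ : VarSpace → VarSpace)
    (D : Set VarSpace) : Prop :=
  θ ∈ K ∧ θ' ∈ K ∧ MapsEquation θ θ' φ D

/-- The domains of equivalence transformations in the joint space: nonempty open convex sets on
which `u > 0`, `g ≠ 0` and `n ≠ 0`. -/
structure IsJointDomain (W : Set JointSpace) : Prop where
  isOpen : IsOpen W
  convex : Convex ℝ W
  nonempty : W.Nonempty
  u_pos : ∀ w ∈ W, 0 < w.1.2.2
  g_ne_zero : ∀ w ∈ W, w.2.2.1 ≠ 0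
  n_ne_zero : ∀ w ∈ W, w.2.2.2 ≠ 0

/-- `Φ`, defined on `W`, belongs to the generalized equivalence (pseudo)group of the class `K`.
It is a point transformation of the joint space, all of whose components may depend on
`(t, x, u, h, g, n)`; when the arbitrary elements of any equation of `K` are inserted, it becomes
a point transformation of the variables that maps this equation to an equation of `K`, and the
arbitrary elements of the latter are given by the remaining components of `Φ`. -/
structure IsGenEquivTransformation (K : Set GenBurgers) (Φ : JointSpace → JointSpace)
    (W : Set JointSpace) : Prop where
  domain : IsJointDomain W
  smooth : ContDiffOn ℝ ∞ Φ W
  jacobian_ne_zero : ∀ w ∈ W, (fderiv ℝ Φ w).det ≠ 0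
  maps : ∀ θ ∈ K, ∀ D : Set VarSpace, IsOpen D → IsConnected D → D ⊆ θ.base →
    (∀ z ∈ D, (z, θ.val z.1) ∈ W) →
    ∃ θ' ∈ K, MapsEquation θ θ' (fun z => (Φ (z, θ.val z.1)).1) D ∧
      ∀ z ∈ D, (Φ (z, θ.val z.1)).2 = θ'.val (Φ (z, θ.val z.1)).1.1

/-- The triple `(θ, θ', φ)`, with `φ` considered on `D`, is induced by `Φ`. -/
def Induces (Φ : JointSpace → JointSpace) (W : Set JointSpace) (θ θ' : GenBurgers)
    (φ : VarSpace → VarSpace) (D : Set VarSpace) : Prop :=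
  ∀ z ∈ D, (z, θ.val z.1) ∈ W ∧ Φ (z, θ.val z.1) = (φ z, θ'.val (φ z).1)

/-- The class `K` is normalized in the generalized sense: each of its admissible transformations
is induced by an element of its generalized equivalence group. -/
def IsNormalizedGen (K : Set GenBurgers) : Prop :=
  ∀ (θ θ' : GenBurgers) (φ : VarSpace → VarSpace) (D : Set VarSpace), IsAdmissible K θ θ' φ D →
    ∃ (Φ : JointSpace → JointSpace) (W : Set JointSpace),
      IsGenEquivTransformation K Φ W ∧ Induces Φ W θ θ' φ D

/-- The transformation of the joint space with the parameters `δ₁`, `δ₀` and `T = T(t)`; the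
parameters are allowed to depend on `n`, and `T n t` is the value of `T` at `t`. -/
noncomputable def burgersTransformation (δ₁ δ₀ : ℝ → ℝ) (T : ℝ → ℝ → ℝ) :
    JointSpace → JointSpace :=
  fun ((t, x, u), (h, g, n)) =>
    ((T n t,
      δ₁ n * x + δ₀ n,
      (δ₁ n / deriv (T n) t) ^ (1 / n) * u),
     (h / deriv (T n) t + deriv (deriv (T n)) t / (n * deriv (T n) t ^ 2),
      δ₁ n ^ 2 / deriv (T n) t * g,
      n))

/-!
The defining equation `u_t + u ^ n u_x + h u = g u_xx` is a condition on second-order jets, and a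
transformation `(T, X, U)` acts on these jets explicitly. For a prescribed jet of `u` that solves
the source equation and is transversal, a quadratic polynomial has this jet and the inverse
function theorem provides the transformed function, so that the target equation becomes an identity
in the jet variables (`MapsEquation.jet`). The second derivative with respect to `x̃` of the
transformed function is computed along the line in the `(t, x)`-plane whose direction `ξ` is mapped
to `∂/∂x̃`; in this form the second derivatives `a = u_tt`, `b = u_tx`, `c = u_xx` enter through the
quadratic form `a ξ₁² + 2 b ξ₁ ξ₂ + c ξ₂²` only.

Splitting this identity gives the determining equations. As `u_tt` is free, `ξ₁ = 0`, which means
`T = T(t)`. The coefficient of `u_xx` then gives `X_u = 0` and `X_x² g = g'(T) T_t`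
(`MapsEquation.pd_space`), and the coefficients of the powers of `u_x` give `U_uu = 0` and a relation
`T_t U ^ n' = X_x u ^ n + K` with `K_u = 0` (`MapsEquation.coefficients`). Differentiating this
relation with respect to `u` shows for `n ≠ 1` that `n' = n`, that `U` is proportional to `u`, and
that `K = 0` (`eq_of_power_relation`); the rest follows (`MapsEquation.determined`). For `n = 1` the
relation is also solved by `U` affine in `u` (Galilean boosts and more), which is why this value is
excluded.

On a connected domain `X_x` and `X - δ₁ x` are therefore constants. That `T` is a function of `t`
on the whole domain, which need not be convex, follows from `g'(T) T_t = δ₁² g` by integration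
(`MapsEquation.time_eq_of_fst_eq`). Conversely, the chain rule shows that all transformations of
the stated form map equations of the class to equations of the class (`mapsEquation_of_time`,
`isGenEquivTransformation_of_eqOn`).

An element of the equivalence group is determined by inserting coefficients `h` and `g` that are
affine in `t`, with arbitrary values and slopes at a point. The conclusions for `n ≠ 1` extend to
`n = 1` by continuity, and the components factor through the projections to `n` and to `(n, t)`,
since the domain is convex (`exists_factor`).
-/

/-! ### Directional derivatives of smooth functions -/

section Calculus

variable {E E' : Type*} [NormedAddCommGroup E] [NormedSpace ℝ E]
  [NormedAddCommGroup E'] [NormedSpace ℝ E']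

/-- The derivative of `F` in the constant direction `v`, as a function of the point. -/
noncomputable def pd (v : E) (F : E → ℝ) (z : E) : ℝ := fderiv ℝ F z v

theorem ContDiffOn.hasFDerivAt_of_isOpen {D : Set E} {F : E → E'} (hF : ContDiffOn ℝ ∞ F D)
    (hD : IsOpen D) {z : E} (hz : z ∈ D) : HasFDerivAt F (fderiv ℝ F z) z :=
  ((hF.contDiffAt (hD.mem_nhds hz)).differentiableAt (by simp)).hasFDerivAt

theorem ContDiffOn.pd {D : Set E} {F : E → ℝ} (hF : ContDiffOn ℝ ∞ F D) (hD : IsOpen D) (v : E) :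
    ContDiffOn ℝ ∞ (pd v F) D :=
  (hF.fderiv_of_isOpen hD (m := ∞) (by simp)).clm_apply contDiffOn_const

theorem HasFDerivAt.pd_eq {F : E → ℝ} {F' : E →L[ℝ] ℝ} {z : E} (h : HasFDerivAt F F' z) (v : E) :
    pd v F z = F' v := by
  rw [_root_.pd, h.fderiv]

theorem pd_eqOn {D : Set E} (hD : IsOpen D) {F G : E → ℝ} (h : EqOn F G D) (v : E) :
    EqOn (pd v F) (pd v G) D := fun z hz => by
  unfold pd
  rw [(h.eventuallyEq_of_mem (hD.mem_nhds hz)).fderiv_eq]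

theorem pd_eq_zero_of_eqOn_const {D : Set E} (hD : IsOpen D) {F : E → ℝ} {c : ℝ}
    (h : ∀ z ∈ D, F z = c) (v : E) {z : E} (hz : z ∈ D) : pd v F z = 0 := by
  have := pd_eqOn hD (F := F) (G := fun _ => c) h v hz
  rw [this]
  simp [pd]

theorem fderiv_fderiv_apply {D : Set E} {F : E → ℝ} (hF : ContDiffOn ℝ ∞ F D) (hD : IsOpen D)
    (v w : E) {z : E} (hz : z ∈ D) : fderiv ℝ (fderiv ℝ F) z v w = pd v (pd w F) z := by
  have h1 : HasFDerivAt (fderiv ℝ F) (fderiv ℝ (fderiv ℝ F) z) z :=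
    (hF.fderiv_of_isOpen hD (m := ∞) (by simp)).hasFDerivAt_of_isOpen hD hz
  have h2 := h1.clm_apply (hasFDerivAt_const w z)
  exact ((h2.pd_eq v).trans (by simp)).symm

theorem pd_comm {D : Set E} {F : E → ℝ} (hF : ContDiffOn ℝ ∞ F D) (hD : IsOpen D)
    (v w : E) {z : E} (hz : z ∈ D) : pd v (pd w F) z = pd w (pd v F) z := by
  rw [← fderiv_fderiv_apply hF hD v w hz, ← fderiv_fderiv_apply hF hD w v hz]
  exact ((hF.contDiffAt (hD.mem_nhds hz)).isSymmSndFDerivAt (n := ∞)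
    (by rw [minSmoothness_of_isRCLikeNormedField]; exact ENat.LEInfty.out)).eq v w

theorem pd_mul {F G : E → ℝ} {z : E} (hF : DifferentiableAt ℝ F z) (hG : DifferentiableAt ℝ G z)
    (v : E) : pd v (fun y => F y * G y) z = pd v F z * G z + F z * pd v G z := by
  refine ((hF.hasFDerivAt.mul hG.hasFDerivAt).pd_eq v).trans ?_
  simp [pd]
  ring

theorem pd_rpow_const {F : E → ℝ} {z : E} (hF : DifferentiableAt ℝ F z) (h0 : 0 < F z) (r : ℝ)
    (v : E) : pd v (fun y => F y ^ r) z = r * F z ^ (r - 1) * pd v F z := by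
  rw [(hF.hasFDerivAt.rpow_const (Or.inl h0.ne')).pd_eq v]
  simp [pd]

theorem pd_mul_of_eq_zero {F G : E → ℝ} {z v : E} (hF : DifferentiableAt ℝ F z)
    (hG : DifferentiableAt ℝ G z) (h0 : pd v F z = 0) :
    pd v (fun y => F y * G y) z = F z * pd v G z := by
  rw [pd_mul hF hG, h0, zero_mul, zero_add]

theorem pd_add {F G : E → ℝ} {z : E} (hF : DifferentiableAt ℝ F z) (hG : DifferentiableAt ℝ G z)
    (v : E) : pd v (fun y => F y + G y) z = pd v F z + pd v G z := by
  refine ((hF.hasFDerivAt.add hG.hasFDerivAt).pd_eq v).trans ?_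
  rfl

theorem pd_comp_real_eq_zero {F : E → ℝ} {f : ℝ → ℝ} {z v : E}
    (hf : DifferentiableAt ℝ f (F z)) (hF : DifferentiableAt ℝ F z) (h0 : pd v F z = 0) :
    pd v (fun y => f (F y)) z = 0 := by
  refine ((hf.hasDerivAt.comp_hasFDerivAt z hF.hasFDerivAt).pd_eq v).trans ?_
  have : fderiv ℝ F z v = 0 := h0
  simp [this]

theorem pd_add_dir (F : E → ℝ) (z v v' : E) :
    pd (v + v') F z = pd v F z + pd v' F z := map_add _ _ _

theorem pd_smul_dir (F : E → ℝ) (z v : E) (a : ℝ) :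
    pd (a • v) F z = a * pd v F z := map_smul _ _ _

theorem pd_comp {F : E' → ℝ} {ι : E → E'} {L : E →L[ℝ] E'} {z : E}
    (hι : HasFDerivAt ι L z) (hF : DifferentiableAt ℝ F (ι z)) (v : E) :
    pd v (fun y => F (ι y)) z = pd (L v) F (ι z) :=
  (hF.hasFDerivAt.comp z hι).pd_eq v

theorem hasDerivAt_comp_curve {F : E → ℝ} {γ : ℝ → E} {γ' : E} {s : ℝ}
    (hF : DifferentiableAt ℝ F (γ s)) (hγ : HasDerivAt γ γ' s) :
    HasDerivAt (fun r => F (γ r)) (fderiv ℝ F (γ s) γ') s :=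
  hF.hasFDerivAt.comp_hasDerivAt s hγ

theorem eventually_hasDerivAt_comp_curve {F : E → ℝ} {γ γ₁ : ℝ → E} {s : ℝ}
    (hF : ContDiffAt ℝ ∞ F (γ s)) (hγ : ∀ᶠ r in 𝓝 s, HasDerivAt γ (γ₁ r) r) :
    ∀ᶠ r in 𝓝 s, HasDerivAt (fun r => F (γ r)) (fderiv ℝ F (γ r) (γ₁ r)) r := by
  have hev : ∀ᶠ y in 𝓝 (γ s), DifferentiableAt ℝ F y := by
    filter_upwards [(hF.of_le (m := 1) (by simp)).eventually (by simp)] with y hy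
    exact hy.differentiableAt (by simp)
  filter_upwards [hγ, hγ.self_of_nhds.continuousAt.eventually hev] with r hr hr'
  exact hasDerivAt_comp_curve hr' hr

theorem hasDerivAt_fderiv_comp_curve {F : E → ℝ} {γ γ₁ : ℝ → E} {γ₂ : E} {s : ℝ}
    (hF : ContDiffAt ℝ ∞ F (γ s)) (hγ : HasDerivAt γ (γ₁ s) s) (hγ₁ : HasDerivAt γ₁ γ₂ s) :
    HasDerivAt (fun r => fderiv ℝ F (γ r) (γ₁ r))
      (fderiv ℝ (fderiv ℝ F) (γ s) (γ₁ s) (γ₁ s) + fderiv ℝ F (γ s) γ₂) s := by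
  have h2 : HasFDerivAt (fderiv ℝ F) (fderiv ℝ (fderiv ℝ F) (γ s)) (γ s) :=
    ((hF.fderiv_right (m := ∞) (by simp)).differentiableAt (by simp)).hasFDerivAt
  exact (h2.comp_hasDerivAt s hγ).clm_apply hγ₁

/-- The second derivative of a function along a curve. -/
theorem deriv_deriv_comp_curve {F : E → ℝ} {γ γ₁ : ℝ → E} {γ₂ : E} {s : ℝ}
    (hF : ContDiffAt ℝ ∞ F (γ s)) (hγ : ∀ᶠ r in 𝓝 s, HasDerivAt γ (γ₁ r) r)
    (hγ₁ : HasDerivAt γ₁ γ₂ s) :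
    deriv (deriv fun r => F (γ r)) s
      = fderiv ℝ (fderiv ℝ F) (γ s) (γ₁ s) (γ₁ s) + fderiv ℝ F (γ s) γ₂ := by
  have h1 : deriv (fun r => F (γ r)) =ᶠ[𝓝 s] fun r => fderiv ℝ F (γ r) (γ₁ r) :=
    (eventually_hasDerivAt_comp_curve hF hγ).mono fun r hr => hr.deriv
  rw [h1.deriv_eq]
  exact (hasDerivAt_fderiv_comp_curve hF hγ.self_of_nhds hγ₁).deriv

theorem ContinuousLinearMap.surjective_of_det_ne_zero [FiniteDimensional ℝ E] {A : E →L[ℝ] E}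
    (hA : A.det ≠ 0) : Function.Surjective A := by
  have h := (A.toContinuousLinearEquivOfDetNeZero hA).surjective
  intro y
  obtain ⟨x, hx⟩ := h y
  exact ⟨x, by simpa using hx⟩

theorem ContinuousLinearMap.det_ne_zero_of_injective [FiniteDimensional ℝ E] {A : E →L[ℝ] E}
    (hA : ∀ v, A v = 0 → v = 0) : A.det ≠ 0 := by
  have hk : LinearMap.ker (A : E →ₗ[ℝ] E) = ⊥ := LinearMap.ker_eq_bot'.2 hA
  have := LinearEquiv.isUnit_det' (LinearEquiv.ofInjectiveEndo (A : E →ₗ[ℝ] E)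
    (LinearMap.ker_eq_bot.1 hk))
  have h2 : ((LinearEquiv.ofInjectiveEndo (A : E →ₗ[ℝ] E)
    (LinearMap.ker_eq_bot.1 hk) : E ≃ₗ[ℝ] E) : E →ₗ[ℝ] E) = A := by ext; simp
  rw [h2] at this
  exact this.ne_zero

end Calculus

/-! ### The action of a point transformation on second-order jets -/

/-- The quadratic polynomial in `(t, x)` with the given second-order jet at `q`. -/
noncomputable def quadJet (q : ℝ × ℝ) (u₀ r p a b c : ℝ) (y : ℝ × ℝ) : ℝ :=
  u₀ + r * (y.1 - q.1) + p * (y.2 - q.2)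
    + (a * (y.1 - q.1) ^ 2 + 2 * b * (y.1 - q.1) * (y.2 - q.2) + c * (y.2 - q.2) ^ 2) / 2

theorem contDiff_quadJet (q : ℝ × ℝ) (u₀ r p a b c : ℝ) :
    ContDiff ℝ ∞ (quadJet q u₀ r p a b c) := by
  unfold quadJet
  fun_prop

/-- The polynomial with a prescribed jet satisfies the equation at the base point of the jet as
soon as the jet lies on the manifold of the equation. -/
theorem holdsAt_quadJet {θ : GenBurgers} {q : ℝ × ℝ} {u₀ r p a b c : ℝ}
    (h : r + u₀ ^ θ.n * p + θ.h q.1 * u₀ = θ.g q.1 * c) :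
    θ.HoldsAt (quadJet q u₀ r p a b c) q := by
  have h0 : quadJet q u₀ r p a b c q = u₀ := by simp [quadJet]
  have h1 : deriv (fun s => quadJet q u₀ r p a b c (s, q.2)) q.1 = r := by
    have : HasDerivAt (fun s => quadJet q u₀ r p a b c (s, q.2)) (r + a * (q.1 - q.1)) q.1 := by
      have e : (fun s => quadJet q u₀ r p a b c (s, q.2)) =
          fun s => u₀ + r * (s - q.1) + a / 2 * (s - q.1) ^ 2 := by
        funext s; simp [quadJet]; ring
      rw [e]
      have := ((hasDerivAt_id q.1).sub_const q.1)
      refine (((this.const_mul r).const_add u₀).add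
        ((this.pow 2).const_mul (a / 2))).congr_deriv ?_
      simp
    rw [this.deriv]; ring
  have h2 : deriv (fun y => quadJet q u₀ r p a b c (q.1, y)) = fun y => p + c * (y - q.2) := by
    funext y
    have e : (fun s => quadJet q u₀ r p a b c (q.1, s)) =
        fun s => u₀ + p * (s - q.2) + c / 2 * (s - q.2) ^ 2 := by
      funext s; simp [quadJet]; ring
    rw [e]
    have := ((hasDerivAt_id y).sub_const q.2)
    refine ((((this.const_mul p).const_add u₀).add
      ((this.pow 2).const_mul (c / 2))).deriv).trans ?_
    simp
    ring
  have h3 : deriv (fun y => p + c * (y - q.2)) q.2 = c := by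
    have := ((((hasDerivAt_id q.2).sub_const q.2).const_mul c).const_add p)
    exact this.deriv.trans (mul_one c)
  unfold GenBurgers.HoldsAt
  rw [h0, h1, h2, h3]
  simp only [sub_self, mul_zero, add_zero]
  exact h

theorem fderiv_fst_comp {φ : VarSpace → VarSpace} {z : VarSpace} (h : DifferentiableAt ℝ φ z)
    (v : VarSpace) : fderiv ℝ (fun z => (φ z).1) z v = (fderiv ℝ φ z v).1 := by
  rw [h.hasFDerivAt.fst.fderiv]; rfl

theorem fderiv_snd_fst_comp {φ : VarSpace → VarSpace} {z : VarSpace} (h : DifferentiableAt ℝ φ z)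
    (v : VarSpace) : fderiv ℝ (fun z => (φ z).2.1) z v = (fderiv ℝ φ z v).2.1 := by
  rw [h.hasFDerivAt.snd.fst.fderiv]; rfl

theorem fderiv_snd_snd_comp {φ : VarSpace → VarSpace} {z : VarSpace} (h : DifferentiableAt ℝ φ z)
    (v : VarSpace) : fderiv ℝ (fun z => (φ z).2.2) z v = (fderiv ℝ φ z v).2.2 := by
  rw [h.hasFDerivAt.snd.snd.fderiv]; rfl

/-- The image of a transversal graph is locally a graph, by the inverse function theorem. -/
theorem exists_mapsGraphAt {φ : VarSpace → VarSpace} {u : ℝ × ℝ → ℝ} {q : ℝ × ℝ}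
    (hu : ContDiffAt ℝ ∞ u q) (hφ : ContDiffAt ℝ ∞ φ (q.1, q.2, u q))
    (hdet : (fderiv ℝ (baseMap φ u) q).det ≠ 0) : ∃ v, MapsGraphAt φ u v q := by
  have hG : ContDiffAt ℝ ∞ (fun p : ℝ × ℝ => φ (p.1, p.2, u p)) q :=
    ContDiffAt.comp q hφ (contDiffAt_fst.prodMk (contDiffAt_snd.prodMk hu))
  have hB : ContDiffAt ℝ ∞ (baseMap φ u) q := hG.fst.prodMk hG.snd.fst
  let e := (fderiv ℝ (baseMap φ u) q).toContinuousLinearEquivOfDetNeZero hdet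
  have he : HasFDerivAt (baseMap φ u) (e : ℝ × ℝ →L[ℝ] ℝ × ℝ) q := by
    simpa [e] using (hB.differentiableAt (by simp)).hasFDerivAt
  let ψ := hB.localInverse he (by simp)
  have hψ : ContDiffAt ℝ ∞ ψ (baseMap φ u q) := hB.to_localInverse he (by simp)
  have hψq : ψ (baseMap φ u q) = q := hB.localInverse_apply_image he (by simp)
  refine ⟨fun r => (φ ((ψ r).1, (ψ r).2, u (ψ r))).2.2, hu, ?_, hdet, ?_⟩
  · have hG' : ContDiffAt ℝ ∞ (fun p : ℝ × ℝ => (φ (p.1, p.2, u p)).2.2)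
        (ψ (baseMap φ u q)) := by
      rw [hψq]
      exact hG.snd.snd
    exact hG'.comp (baseMap φ u q) hψ
  · have : ∀ᶠ p in 𝓝 q, ψ (baseMap φ u p) = p :=
      (hB.hasStrictFDerivAt' he (by simp)).eventually_left_inverse
    filter_upwards [this] with p hp
    simp only [hp]

/-- The target equation in terms of the source jet. The jet of `u` is `(u, r, p, a, b, c)`, the
numbers `v₁, v₂` are the first derivatives of the transformed function, and its second derivative
with respect to `x̃` is computed along the line in the `(t, x)`-plane with the direction
`ξ = (ξ₁, ξ₂)` that is mapped to `∂/∂x̃`. -/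
theorem MapsEquation.jet {θ θ' : GenBurgers} {φ : VarSpace → VarSpace} {D : Set VarSpace}
    (H : MapsEquation θ θ' φ D) {z : VarSpace} (hz : z ∈ D) {r p a b c v₁ v₂ Δ ξ₁ ξ₂ : ℝ}
    (hΔ : Δ = (fderiv ℝ φ z (1, 0, r)).1 * (fderiv ℝ φ z (0, 1, p)).2.1
      - (fderiv ℝ φ z (0, 1, p)).1 * (fderiv ℝ φ z (1, 0, r)).2.1) (hΔ0 : Δ ≠ 0)
    (hv₁ : (fderiv ℝ φ z (1, 0, r)).2.2
      = v₁ * (fderiv ℝ φ z (1, 0, r)).1 + v₂ * (fderiv ℝ φ z (1, 0, r)).2.1)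
    (hv₂ : (fderiv ℝ φ z (0, 1, p)).2.2
      = v₁ * (fderiv ℝ φ z (0, 1, p)).1 + v₂ * (fderiv ℝ φ z (0, 1, p)).2.1)
    (hξ₁ : Δ * ξ₁ = -(fderiv ℝ φ z (0, 1, p)).1) (hξ₂ : Δ * ξ₂ = (fderiv ℝ φ z (1, 0, r)).1)
    (hsol : r + z.2.2 ^ θ.n * p + θ.h z.1 * z.2.2 = θ.g z.1 * c) :
    v₁ + (φ z).2.2 ^ θ'.n * v₂ + θ'.h (φ z).1 * (φ z).2.2 = θ'.g (φ z).1 *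
      (fderiv ℝ (fderiv ℝ fun z => (φ z).2.2) z (ξ₁, ξ₂, ξ₁ * r + ξ₂ * p)
          (ξ₁, ξ₂, ξ₁ * r + ξ₂ * p)
        - v₁ * fderiv ℝ (fderiv ℝ fun z => (φ z).1) z (ξ₁, ξ₂, ξ₁ * r + ξ₂ * p)
          (ξ₁, ξ₂, ξ₁ * r + ξ₂ * p)
        - v₂ * fderiv ℝ (fderiv ℝ fun z => (φ z).2.1) z (ξ₁, ξ₂, ξ₁ * r + ξ₂ * p)
          (ξ₁, ξ₂, ξ₁ * r + ξ₂ * p)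
        + ((fderiv ℝ φ z (0, 0, 1)).2.2 - v₁ * (fderiv ℝ φ z (0, 0, 1)).1
            - v₂ * (fderiv ℝ φ z (0, 0, 1)).2.1) * (a * ξ₁ ^ 2 + 2 * b * ξ₁ * ξ₂ + c * ξ₂ ^ 2)) := by
  obtain ⟨t₀, x₀, u₀⟩ := z
  set q : ℝ × ℝ := (t₀, x₀) with hq
  set z : VarSpace := (t₀, x₀, u₀) with hzdef
  set u := quadJet q u₀ r p a b c with hu
  have huq : u q = u₀ := by simp [hu, quadJet]
  have hzq : (q.1, q.2, u q) = z := by rw [huq]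
  have hφ : ContDiffAt ℝ ∞ φ z := H.isPoint.smooth.contDiffAt (H.isPoint.isOpen.mem_nhds hz)
  have hφd : DifferentiableAt ℝ φ z := hφ.differentiableAt (by simp)
  have hus : ContDiff ℝ ∞ u := contDiff_quadJet ..
  -- the curve in the graph over a line through the base point
  let Γ : ℝ → ℝ → ℝ → VarSpace := fun e₁ e₂ s =>
    (t₀ + s * e₁, x₀ + s * e₂, u (t₀ + s * e₁, x₀ + s * e₂))
  let Q : ℝ → ℝ → ℝ := fun e₁ e₂ => a * e₁ ^ 2 + 2 * b * e₁ * e₂ + c * e₂ ^ 2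
  let Γ₁ : ℝ → ℝ → ℝ → VarSpace := fun e₁ e₂ s => (e₁, e₂, e₁ * r + e₂ * p + s * Q e₁ e₂)
  have hΓ : ∀ e₁ e₂ s, HasDerivAt (Γ e₁ e₂) (Γ₁ e₁ e₂ s) s := by
    intro e₁ e₂ s
    have h0 := hasDerivAt_id s
    have h3 : HasDerivAt (fun s => u (t₀ + s * e₁, x₀ + s * e₂))
        (e₁ * r + e₂ * p + s * Q e₁ e₂) s := by
      have e : (fun s => u (t₀ + s * e₁, x₀ + s * e₂)) =
          fun s => u₀ + (e₁ * r + e₂ * p) * s + Q e₁ e₂ / 2 * s ^ 2 := by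
        funext s; simp [hu, quadJet, hq, Q]; ring
      rw [e]
      refine (((h0.const_mul (e₁ * r + e₂ * p)).const_add u₀).add
        ((h0.pow 2).const_mul (Q e₁ e₂ / 2))).congr_deriv ?_
      simp
      ring
    have h1 : HasDerivAt (fun s : ℝ => t₀ + s * e₁) e₁ s := by
      simpa using (h0.mul_const e₁).const_add t₀
    have h2 : HasDerivAt (fun s : ℝ => x₀ + s * e₂) e₂ s := by
      simpa using (h0.mul_const e₂).const_add x₀
    exact h1.prodMk (h2.prodMk h3)
  have hΓ₁ : ∀ e₁ e₂, HasDerivAt (Γ₁ e₁ e₂) (0, 0, Q e₁ e₂) 0 := by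
    intro e₁ e₂
    have h3 : HasDerivAt (fun s => e₁ * r + e₂ * p + s * Q e₁ e₂) (Q e₁ e₂) 0 := by
      simpa using ((hasDerivAt_id (0 : ℝ)).mul_const (Q e₁ e₂)).const_add (e₁ * r + e₂ * p)
    exact (hasDerivAt_const (0 : ℝ) e₁).prodMk ((hasDerivAt_const (0 : ℝ) e₂).prodMk h3)
  have hΓ0 : ∀ e₁ e₂, Γ e₁ e₂ 0 = z := by
    intro e₁ e₂
    simp only [Γ, zero_mul, add_zero]
    rw [← hq, huq]
  have hΓ₁0 : ∀ e₁ e₂, Γ₁ e₁ e₂ 0 = (e₁, e₂, e₁ * r + e₂ * p) := by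
    intro e₁ e₂
    simp [Γ₁]
  have hline : ∀ e₁ e₂ : ℝ,
      HasDerivAt (fun s : ℝ => ((t₀ + s * e₁, x₀ + s * e₂) : ℝ × ℝ)) (e₁, e₂) 0 := by
    intro e₁ e₂
    have h0 := hasDerivAt_id (0 : ℝ)
    have h1 : HasDerivAt (fun s : ℝ => t₀ + s * e₁) e₁ 0 := by
      simpa using (h0.mul_const e₁).const_add t₀
    have h2 : HasDerivAt (fun s : ℝ => x₀ + s * e₂) e₂ 0 := by
      simpa using (h0.mul_const e₂).const_add x₀
    exact h1.prodMk h2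
  have hline0 : ∀ e₁ e₂ : ℝ, ((t₀ + 0 * e₁, x₀ + 0 * e₂) : ℝ × ℝ) = q := by
    intro e₁ e₂; simp [hq]
  have hlin : ∀ e₁ e₂ : ℝ, fderiv ℝ φ z (e₁, e₂, e₁ * r + e₂ * p)
      = e₁ • fderiv ℝ φ z (1, 0, r) + e₂ • fderiv ℝ φ z (0, 1, p) := by
    intro e₁ e₂
    rw [← map_smul, ← map_smul, ← map_add]
    simp
  -- the derivative of the map of the independent variables
  have hBd : DifferentiableAt ℝ (baseMap φ u) q := by
    have h1 : ContDiffAt ℝ ∞ φ (q.1, q.2, u q) := by rw [hzq]; exact hφ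
    have hG : ContDiffAt ℝ ∞ (fun p : ℝ × ℝ => φ (p.1, p.2, u p)) q :=
      h1.comp q (contDiffAt_fst.prodMk (contDiffAt_snd.prodMk hus.contDiffAt))
    exact (hG.fst.prodMk hG.snd.fst).differentiableAt (by simp)
  have hφΓ : ∀ e₁ e₂, HasDerivAt (fun s => φ (Γ e₁ e₂ s))
      (fderiv ℝ φ z (e₁, e₂, e₁ * r + e₂ * p)) 0 := by
    intro e₁ e₂
    have h1 := hΓ e₁ e₂ 0
    rw [hΓ₁0] at h1
    have h2 : HasFDerivAt φ (fderiv ℝ φ z) (Γ e₁ e₂ 0) := by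
      rw [hΓ0]; exact hφd.hasFDerivAt
    exact h2.comp_hasDerivAt 0 h1
  have hB : ∀ e₁ e₂ : ℝ, fderiv ℝ (baseMap φ u) q (e₁, e₂)
      = ((fderiv ℝ φ z (e₁, e₂, e₁ * r + e₂ * p)).1,
        (fderiv ℝ φ z (e₁, e₂, e₁ * r + e₂ * p)).2.1) := by
    intro e₁ e₂
    have h1 : HasFDerivAt (baseMap φ u) (fderiv ℝ (baseMap φ u) q) (t₀ + 0 * e₁, x₀ + 0 * e₂) := by
      rw [hline0]; exact hBd.hasFDerivAt
    have h2 := h1.comp_hasDerivAt 0 (hline e₁ e₂)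
    have h3 := hφΓ e₁ e₂
    exact h2.unique (h3.fst.prodMk h3.snd.fst)
  have hdet : (fderiv ℝ (baseMap φ u) q).det ≠ 0 := by
    refine ContinuousLinearMap.det_ne_zero_of_injective ?_
    rintro ⟨e₁, e₂⟩ he
    rw [hB, hlin] at he
    simp only [Prod.mk_eq_zero, Prod.fst_add, Prod.smul_fst, Prod.snd_add, Prod.smul_snd,
      smul_eq_mul] at he
    obtain ⟨h1, h2⟩ := he
    have he1 : Δ * e₁ = 0 := by
      rw [hΔ]; linear_combination (fderiv ℝ φ z (0, 1, p)).2.1 * h1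
        - (fderiv ℝ φ z (0, 1, p)).1 * h2
    have he2 : Δ * e₂ = 0 := by
      rw [hΔ]; linear_combination (fderiv ℝ φ z (1, 0, r)).1 * h2
        - (fderiv ℝ φ z (1, 0, r)).2.1 * h1
    simp only [mul_eq_zero, hΔ0, false_or] at he1 he2
    simp [he1, he2]
  obtain ⟨v, hv⟩ := exists_mapsGraphAt (φ := φ) (q := q) hus.contDiffAt (by rw [hzq]; exact hφ) hdet
  have hH := (H.maps u v q (by rw [hzq]; exact hz) hv).1 (holdsAt_quadJet (by simpa using hsol))
  have hvs := hv.smooth_target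
  have hBq : baseMap φ u q = ((φ z).1, (φ z).2.1) := by
    simp only [baseMap, hzq]
  have hvd : HasFDerivAt v (fderiv ℝ v (baseMap φ u q)) (baseMap φ u q) :=
    (hvs.differentiableAt (by simp)).hasFDerivAt
  -- the identity defining `v`, along the curves
  have hvΓ : ∀ e₁ e₂, (fun s => v ((φ (Γ e₁ e₂ s)).1, (φ (Γ e₁ e₂ s)).2.1))
      =ᶠ[𝓝 0] fun s => (φ (Γ e₁ e₂ s)).2.2 := by
    intro e₁ e₂
    have h1 := (hline e₁ e₂).continuousAt
    have h2 : Filter.Tendsto (fun s : ℝ => ((t₀ + s * e₁, x₀ + s * e₂) : ℝ × ℝ)) (𝓝 0) (𝓝 q) := by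
      have := h1.tendsto
      rwa [hline0] at this
    exact h2.eventually hv.graph
  have hβ0 : ∀ e₁ e₂, (((φ (Γ e₁ e₂ 0)).1, (φ (Γ e₁ e₂ 0)).2.1) : ℝ × ℝ) = baseMap φ u q := by
    intro e₁ e₂; rw [hΓ0, hBq]
  have hv1 : ∀ e₁ e₂, fderiv ℝ v (baseMap φ u q) ((fderiv ℝ φ z (e₁, e₂, e₁ * r + e₂ * p)).1,
      (fderiv ℝ φ z (e₁, e₂, e₁ * r + e₂ * p)).2.1)
      = (fderiv ℝ φ z (e₁, e₂, e₁ * r + e₂ * p)).2.2 := by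
    intro e₁ e₂
    have h3 := hφΓ e₁ e₂
    have h1 : HasFDerivAt v (fderiv ℝ v (baseMap φ u q))
        ((φ (Γ e₁ e₂ 0)).1, (φ (Γ e₁ e₂ 0)).2.1) := by rw [hβ0]; exact hvd
    have h4 : HasDerivAt (fun s => (((φ (Γ e₁ e₂ s)).1, (φ (Γ e₁ e₂ s)).2.1) : ℝ × ℝ))
        ((fderiv ℝ φ z (e₁, e₂, e₁ * r + e₂ * p)).1,
          (fderiv ℝ φ z (e₁, e₂, e₁ * r + e₂ * p)).2.1) 0 := h3.fst.prodMk h3.snd.fst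
    have h2 := h1.comp_hasDerivAt (0 : ℝ) h4
    have h5 : HasDerivAt (fun s => (φ (Γ e₁ e₂ s)).2.2)
        (fderiv ℝ φ z (e₁, e₂, e₁ * r + e₂ * p)).2.2 0 := h3.snd.snd
    exact h2.unique (h5.congr_of_eventuallyEq (hvΓ e₁ e₂))
  have hpair : ∀ A B : ℝ, fderiv ℝ v (baseMap φ u q) (A, B)
      = A * fderiv ℝ v (baseMap φ u q) (1, 0) + B * fderiv ℝ v (baseMap φ u q) (0, 1) := by
    intro A B
    rw [← smul_eq_mul, ← smul_eq_mul, ← map_smul, ← map_smul, ← map_add]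
    simp
  have hτ := hv1 1 0
  have hχ := hv1 0 1
  simp only [one_mul, zero_mul, add_zero, zero_add] at hτ hχ
  rw [hpair] at hτ hχ
  set V₁ := fderiv ℝ v (baseMap φ u q) (1, 0) with hV₁
  set V₂ := fderiv ℝ v (baseMap φ u q) (0, 1) with hV₂
  have e1 : V₁ = v₁ := by
    refine mul_left_cancel₀ hΔ0 ?_
    rw [hΔ]
    linear_combination (fderiv ℝ φ z (0, 1, p)).2.1 * (hτ + hv₁)
      - (fderiv ℝ φ z (1, 0, r)).2.1 * (hχ + hv₂)
  have e2 : V₂ = v₂ := by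
    refine mul_left_cancel₀ hΔ0 ?_
    rw [hΔ]
    linear_combination (fderiv ℝ φ z (1, 0, r)).1 * (hχ + hv₂)
      - (fderiv ℝ φ z (0, 1, p)).1 * (hτ + hv₁)
  -- the second derivative along the line that is mapped to the `x̃`-direction
  set w : VarSpace := (ξ₁, ξ₂, ξ₁ * r + ξ₂ * p) with hw
  have hw1 : (fderiv ℝ φ z w).1 = 0 := by
    refine mul_left_cancel₀ hΔ0 ?_
    rw [hw, hlin]
    simp only [Prod.fst_add, Prod.smul_fst, smul_eq_mul]
    linear_combination (fderiv ℝ φ z (1, 0, r)).1 * hξ₁ + (fderiv ℝ φ z (0, 1, p)).1 * hξ₂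
  have hw2 : (fderiv ℝ φ z w).2.1 = 1 := by
    refine mul_left_cancel₀ hΔ0 ?_
    rw [hw, hlin]
    simp only [Prod.fst_add, Prod.smul_fst, Prod.snd_add, Prod.smul_snd, smul_eq_mul]
    linear_combination (fderiv ℝ φ z (1, 0, r)).2.1 * hξ₁
      + (fderiv ℝ φ z (0, 1, p)).2.1 * hξ₂ - hΔ
  have hsT : ContDiffAt ℝ ∞ (fun z => (φ z).1) z := hφ.fst
  have hsX : ContDiffAt ℝ ∞ (fun z => (φ z).2.1) z := hφ.snd.fst
  have hsU : ContDiffAt ℝ ∞ (fun z => (φ z).2.2) z := hφ.snd.snd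
  have hΓev : ∀ᶠ s in 𝓝 (0 : ℝ), HasDerivAt (Γ ξ₁ ξ₂) (Γ₁ ξ₁ ξ₂ s) s :=
    Filter.Eventually.of_forall (hΓ ξ₁ ξ₂)
  have hw0 : Γ₁ ξ₁ ξ₂ 0 = w := hΓ₁0 ξ₁ ξ₂
  have hz0 := hΓ0 ξ₁ ξ₂
  rw [← hz0] at hsT hsX hsU
  have dT := eventually_hasDerivAt_comp_curve hsT hΓev
  have dX := eventually_hasDerivAt_comp_curve hsX hΓev
  have ddT := hasDerivAt_fderiv_comp_curve hsT (hΓ ξ₁ ξ₂ 0) (hΓ₁ ξ₁ ξ₂)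
  have ddX := hasDerivAt_fderiv_comp_curve hsX (hΓ ξ₁ ξ₂ 0) (hΓ₁ ξ₁ ξ₂)
  have ddU := deriv_deriv_comp_curve hsU hΓev (hΓ₁ ξ₁ ξ₂)
  have dβ : ∀ᶠ s in 𝓝 (0 : ℝ), HasDerivAt
      (fun s => (((φ (Γ ξ₁ ξ₂ s)).1, (φ (Γ ξ₁ ξ₂ s)).2.1) : ℝ × ℝ))
      ((fun s => ((fderiv ℝ (fun z => (φ z).1) (Γ ξ₁ ξ₂ s) (Γ₁ ξ₁ ξ₂ s),
        fderiv ℝ (fun z => (φ z).2.1) (Γ ξ₁ ξ₂ s) (Γ₁ ξ₁ ξ₂ s)) : ℝ × ℝ)) s) s := by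
    filter_upwards [dT, dX] with s h1 h2
    exact h1.prodMk h2
  have hvs' : ContDiffAt ℝ ∞ v ((φ (Γ ξ₁ ξ₂ 0)).1, (φ (Γ ξ₁ ξ₂ 0)).2.1) := by
    rw [hβ0]; exact hvs
  have ddv := deriv_deriv_comp_curve (F := v)
    (γ := fun s => (((φ (Γ ξ₁ ξ₂ s)).1, (φ (Γ ξ₁ ξ₂ s)).2.1) : ℝ × ℝ)) hvs' dβ (ddT.prodMk ddX)
  have hcong : deriv (deriv fun s => v ((φ (Γ ξ₁ ξ₂ s)).1, (φ (Γ ξ₁ ξ₂ s)).2.1)) 0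
      = deriv (deriv fun s => (φ (Γ ξ₁ ξ₂ s)).2.2) 0 :=
    (hvΓ ξ₁ ξ₂).deriv.deriv_eq
  rw [ddv, ddU] at hcong
  simp only [hz0, hw0, ← hBq] at hcong
  have hu0 : ∀ s : ℝ, ((0, 0, s) : VarSpace) = s • (0, 0, 1) := by intro s; simp
  rw [fderiv_fst_comp hφd, fderiv_snd_fst_comp hφd, hw1, hw2, hpair, hu0 (Q ξ₁ ξ₂)] at hcong
  simp only [map_smul, fderiv_fst_comp hφd, fderiv_snd_fst_comp hφd, fderiv_snd_snd_comp hφd,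
    Prod.smul_fst, Prod.smul_snd, smul_eq_mul] at hcong
  rw [e1, e2] at hcong
  -- the partial derivatives of `v` in the target equation
  have hxline : ∀ y : ℝ, HasDerivAt (fun y : ℝ => (((baseMap φ u q).1, y) : ℝ × ℝ)) (0, 1) y :=
    fun y => (hasDerivAt_const y _).prodMk (hasDerivAt_id y)
  have htline : HasDerivAt (fun s : ℝ => ((s, (baseMap φ u q).2) : ℝ × ℝ)) (1, 0)
    (baseMap φ u q).1 := (hasDerivAt_id _).prodMk (hasDerivAt_const _ _)
  have p1 : deriv (fun s => v (s, (baseMap φ u q).2)) (baseMap φ u q).1 = v₁ := by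
    rw [← e1]
    exact (hasDerivAt_comp_curve (F := v) (γ := fun s : ℝ => ((s, (baseMap φ u q).2) : ℝ × ℝ))
      hvd.differentiableAt htline).deriv
  have p2 : deriv (fun y => v ((baseMap φ u q).1, y)) (baseMap φ u q).2 = v₂ := by
    rw [← e2]
    exact (hasDerivAt_comp_curve (F := v) (γ := fun y : ℝ => (((baseMap φ u q).1, y) : ℝ × ℝ))
      hvd.differentiableAt (hxline _)).deriv
  have p22 : deriv (deriv (fun y => v ((baseMap φ u q).1, y))) (baseMap φ u q).2
      = fderiv ℝ (fderiv ℝ v) (baseMap φ u q) (0, 1) (0, 1) := by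
    have := deriv_deriv_comp_curve (F := v) (γ := fun y : ℝ => (((baseMap φ u q).1, y) : ℝ × ℝ))
      (γ₁ := fun _ => (0, 1)) (γ₂ := 0) (s := (baseMap φ u q).2) hvs
      (Filter.Eventually.of_forall hxline) (hasDerivAt_const _ _)
    rw [map_zero, add_zero] at this
    exact this
  have hvq : v (baseMap φ u q) = (φ z).2.2 := by
    rw [hv.graph.self_of_nhds, hzq]
  unfold GenBurgers.HoldsAt at hH
  rw [p1, p2, p22, hvq] at hH
  have hB1 : (baseMap φ u q).1 = (φ z).1 := by rw [hBq]
  rw [hB1] at hH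
  rw [hH]
  congr 1
  simp only [Q] at hcong
  linear_combination hcong

/-! ### Determining equations -/

local notation "∂ₜ" => pd ((1, 0, 0) : VarSpace)
local notation "∂ₓ" => pd ((0, 1, 0) : VarSpace)
local notation "∂ᵤ" => pd ((0, 0, 1) : VarSpace)

theorem pd_varSpace (F : VarSpace → ℝ) (z : VarSpace) (a b c : ℝ) :
    pd (a, b, c) F z = a * ∂ₜ F z + b * ∂ₓ F z + c * ∂ᵤ F z := by
  unfold pd
  rw [← smul_eq_mul, ← smul_eq_mul, ← smul_eq_mul, ← map_smul, ← map_smul, ← map_smul,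
    ← map_add, ← map_add]
  simp

/-- The total derivative with respect to `t` when `u_t = r`. -/
theorem pd_one_zero (F : VarSpace → ℝ) (z : VarSpace) (r : ℝ) :
    pd (1, 0, r) F z = ∂ₜ F z + r * ∂ᵤ F z := by
  rw [pd_varSpace]; ring

/-- The total derivative with respect to `x` when `u_x = p`. -/
theorem pd_zero_one (F : VarSpace → ℝ) (z : VarSpace) (p : ℝ) :
    pd (0, 1, p) F z = ∂ₓ F z + p * ∂ᵤ F z := by
  rw [pd_varSpace]; ring

section Determining

variable {θ θ' : GenBurgers} {φ : VarSpace → VarSpace} {D : Set VarSpace}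

theorem IsPointTransformation.differentiableAt (P : IsPointTransformation φ D) {z : VarSpace}
    (hz : z ∈ D) : DifferentiableAt ℝ φ z :=
  (P.smooth.hasFDerivAt_of_isOpen P.isOpen hz).differentiableAt

/-- The gradients of the components of a point transformation are linearly independent: there are
vectors with prescribed derivatives of the components. -/
theorem IsPointTransformation.exists_pd_eq (P : IsPointTransformation φ D) {z : VarSpace}
    (hz : z ∈ D) (α β γ : ℝ) : ∃ v : VarSpace, pd v (fun z => (φ z).1) z = α ∧
      pd v (fun z => (φ z).2.1) z = β ∧ pd v (fun z => (φ z).2.2) z = γ := by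
  obtain ⟨v, hv⟩ := ContinuousLinearMap.surjective_of_det_ne_zero (P.jacobian_ne_zero z hz)
    (α, β, γ)
  have hd := P.differentiableAt hz
  refine ⟨v, ?_, ?_, ?_⟩
  · rw [pd, fderiv_fst_comp hd, hv]
  · rw [pd, fderiv_snd_fst_comp hd, hv]
  · rw [pd, fderiv_snd_snd_comp hd, hv]

/-- The consequence of `MapsEquation.jet` for jets with `u_xx` determined by the equation and
`u_tt` free: the direction mapped to `∂/∂x̃` has no `t`-component. -/
theorem MapsEquation.pd_fst_mul_eq_zero (H : MapsEquation θ θ' φ D) {z : VarSpace} (hz : z ∈ D)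
    (r p : ℝ) :
    (pd (1, 0, r) (fun z => (φ z).1) z * pd (0, 1, p) (fun z => (φ z).2.1) z
      - pd (0, 1, p) (fun z => (φ z).1) z * pd (1, 0, r) (fun z => (φ z).2.1) z)
      * pd (0, 1, p) (fun z => (φ z).1) z = 0 := by
  have hd := H.isPoint.differentiableAt hz
  have eT : ∀ v, pd v (fun z => (φ z).1) z = (fderiv ℝ φ z v).1 := fderiv_fst_comp hd
  have eX : ∀ v, pd v (fun z => (φ z).2.1) z = (fderiv ℝ φ z v).2.1 := fderiv_snd_fst_comp hd
  have eU : ∀ v, pd v (fun z => (φ z).2.2) z = (fderiv ℝ φ z v).2.2 := fderiv_snd_snd_comp hd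
  obtain ⟨Δ, hΔ⟩ : ∃ Δ, Δ = pd (1, 0, r) (fun z => (φ z).1) z * pd (0, 1, p) (fun z => (φ z).2.1) z
      - pd (0, 1, p) (fun z => (φ z).1) z * pd (1, 0, r) (fun z => (φ z).2.1) z := ⟨_, rfl⟩
  rw [← hΔ, mul_eq_zero, or_iff_not_imp_left]
  intro hΔ0
  obtain ⟨v₁, hv₁⟩ : ∃ v₁, Δ * v₁ =
      pd (1, 0, r) (fun z => (φ z).2.2) z * pd (0, 1, p) (fun z => (φ z).2.1) z
      - pd (0, 1, p) (fun z => (φ z).2.2) z * pd (1, 0, r) (fun z => (φ z).2.1) z :=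
    ⟨_, mul_div_cancel₀ _ hΔ0⟩
  obtain ⟨v₂, hv₂⟩ : ∃ v₂, Δ * v₂ =
      pd (1, 0, r) (fun z => (φ z).1) z * pd (0, 1, p) (fun z => (φ z).2.2) z
      - pd (0, 1, p) (fun z => (φ z).1) z * pd (1, 0, r) (fun z => (φ z).2.2) z :=
    ⟨_, mul_div_cancel₀ _ hΔ0⟩
  obtain ⟨ξ₁, hξ₁⟩ : ∃ ξ₁, Δ * ξ₁ = -pd (0, 1, p) (fun z => (φ z).1) z :=
    ⟨_, mul_div_cancel₀ _ hΔ0⟩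
  obtain ⟨ξ₂, hξ₂⟩ : ∃ ξ₂, Δ * ξ₂ = pd (1, 0, r) (fun z => (φ z).1) z :=
    ⟨_, mul_div_cancel₀ _ hΔ0⟩
  have hτ : pd (1, 0, r) (fun z => (φ z).2.2) z = v₁ * pd (1, 0, r) (fun z => (φ z).1) z
      + v₂ * pd (1, 0, r) (fun z => (φ z).2.1) z := by
    refine mul_left_cancel₀ hΔ0 ?_
    linear_combination pd (1, 0, r) (fun z => (φ z).2.2) z * hΔ
      - pd (1, 0, r) (fun z => (φ z).1) z * hv₁ - pd (1, 0, r) (fun z => (φ z).2.1) z * hv₂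
  have hχ : pd (0, 1, p) (fun z => (φ z).2.2) z = v₁ * pd (0, 1, p) (fun z => (φ z).1) z
      + v₂ * pd (0, 1, p) (fun z => (φ z).2.1) z := by
    refine mul_left_cancel₀ hΔ0 ?_
    linear_combination pd (0, 1, p) (fun z => (φ z).2.2) z * hΔ
      - pd (0, 1, p) (fun z => (φ z).1) z * hv₁ - pd (0, 1, p) (fun z => (φ z).2.1) z * hv₂
  -- otherwise the gradient of `U` would be `v₁` times that of `T` plus `v₂` times that of `X`
  have hκ : ∂ᵤ (fun z => (φ z).2.2) z - v₁ * ∂ᵤ (fun z => (φ z).1) z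
      - v₂ * ∂ᵤ (fun z => (φ z).2.1) z ≠ 0 := by
    intro h0
    obtain ⟨⟨y₁, y₂, y₃⟩, h1, h2, h3⟩ := H.isPoint.exists_pd_eq hz 0 0 1
    rw [pd_varSpace] at h1 h2 h3
    rw [pd_one_zero _ z r, pd_one_zero _ z r, pd_one_zero _ z r] at hτ
    rw [pd_zero_one _ z p, pd_zero_one _ z p, pd_zero_one _ z p] at hχ
    refine one_ne_zero (α := ℝ) ?_
    linear_combination -h3 + v₁ * h1 + v₂ * h2 + y₁ * hτ + y₂ * hχ + (y₃ - r * y₁ - p * y₂) * h0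
  have hg : θ.g z.1 ≠ 0 := θ.g_ne_zero _ (H.source hz).1
  have hg' : θ'.g (φ z).1 ≠ 0 := θ'.g_ne_zero _ (H.target hz).1
  have hsol : r + z.2.2 ^ θ.n * p + θ.h z.1 * z.2.2
      = θ.g z.1 * ((r + z.2.2 ^ θ.n * p + θ.h z.1 * z.2.2) / θ.g z.1) :=
    (mul_div_cancel₀ _ hg).symm
  rw [eT, eT, eX, eX] at hΔ
  rw [eU, eT, eX] at hτ hχ
  rw [eT] at hξ₁ hξ₂ ⊢
  rw [eT, eX, eU] at hκ
  -- the source equation does not restrict `a = u_tt`, so that its coefficient vanishes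
  have J0 := H.jet hz (a := 0) (b := 0) hΔ hΔ0 hτ hχ hξ₁ hξ₂ hsol
  have J1 := H.jet hz (a := 1) (b := 0) hΔ hΔ0 hτ hχ hξ₁ hξ₂ hsol
  have h0 : θ'.g (φ z).1 * (((fderiv ℝ φ z (0, 0, 1)).2.2 - v₁ * (fderiv ℝ φ z (0, 0, 1)).1
            - v₂ * (fderiv ℝ φ z (0, 0, 1)).2.1) * ξ₁ ^ 2) = 0 := by
    linear_combination J0 - J1
  have h1 : ξ₁ = 0 := by simpa [hg', hκ] using h0
  rw [h1] at hξ₁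
  linarith

/-- `T` depends on `t` only. By `MapsEquation.pd_fst_mul_eq_zero`, the product of `T_x + p T_u`
with a polynomial in the free jet variables `r` and `p` vanishes identically; if the first factor
does not, all coefficients of the second one vanish, and these are the `2 × 2` minors of the
gradients of `T` and `X`, which are linearly independent. -/
theorem MapsEquation.pd_time_eq_zero (H : MapsEquation θ θ' φ D) {z : VarSpace} (hz : z ∈ D) :
    ∂ₓ (fun z => (φ z).1) z = 0 ∧ ∂ᵤ (fun z => (φ z).1) z = 0 := by
  by_contra hne
  have key : ∀ r p : ℝ, ((∂ₜ (fun z => (φ z).1) z + r * ∂ᵤ (fun z => (φ z).1) z)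
      * (∂ₓ (fun z => (φ z).2.1) z + p * ∂ᵤ (fun z => (φ z).2.1) z)
      - (∂ₓ (fun z => (φ z).1) z + p * ∂ᵤ (fun z => (φ z).1) z)
      * (∂ₜ (fun z => (φ z).2.1) z + r * ∂ᵤ (fun z => (φ z).2.1) z))
      * (∂ₓ (fun z => (φ z).1) z + p * ∂ᵤ (fun z => (φ z).1) z) = 0 := by
    intro r p
    rw [← pd_one_zero, ← pd_one_zero, ← pd_zero_one, ← pd_zero_one]
    exact H.pd_fst_mul_eq_zero hz r p
  obtain ⟨⟨y₁, y₂, y₃⟩, h1, h2, -⟩ := H.isPoint.exists_pd_eq hz 1 0 0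
  obtain ⟨⟨w₁, w₂, w₃⟩, k1, k2, -⟩ := H.isPoint.exists_pd_eq hz 0 1 0
  rw [pd_varSpace] at h1 h2 k1 k2
  generalize ∂ₜ (fun z => (φ z).1) z = Tt at *
  generalize ∂ₓ (fun z => (φ z).1) z = Tx at *
  generalize ∂ᵤ (fun z => (φ z).1) z = Tu at *
  generalize ∂ₜ (fun z => (φ z).2.1) z = Xt at *
  generalize ∂ₓ (fun z => (φ z).2.1) z = Xx at *
  generalize ∂ᵤ (fun z => (φ z).2.1) z = Xu at *
  -- two slopes at which the total derivative of `T` with respect to `x` does not vanish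
  obtain ⟨p, p', hpp, hp, hp'⟩ : ∃ p p' : ℝ, p ≠ p' ∧ Tx + p * Tu ≠ 0 ∧ Tx + p' * Tu ≠ 0 := by
    by_cases hTu : Tu = 0
    · have : Tx ≠ 0 := fun h => hne ⟨h, hTu⟩
      exact ⟨0, 1, by norm_num, by simpa [hTu], by simpa [hTu]⟩
    · refine ⟨(1 - Tx) / Tu, (2 - Tx) / Tu, ?_, ?_, ?_⟩
      · intro h
        rw [div_left_inj' hTu] at h
        linarith
      · rw [div_mul_cancel₀ _ hTu]; norm_num
      · rw [div_mul_cancel₀ _ hTu]; norm_num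
  have red : ∀ r s : ℝ, Tx + s * Tu ≠ 0 →
      (Tt + r * Tu) * (Xx + s * Xu) - (Tx + s * Tu) * (Xt + r * Xu) = 0 := by
    intro r s hs
    exact (mul_eq_zero.1 (key r s)).resolve_right hs
  have a1 := red 0 p hp
  have a2 := red 1 p hp
  have a3 := red 0 p' hp'
  have d2 : Tt * Xu - Tu * Xt = 0 := by
    refine mul_left_cancel₀ (sub_ne_zero.2 hpp) ?_
    linear_combination a1 - a3
  have d0 : Tt * Xx - Tx * Xt = 0 := by linear_combination a1 - p * d2
  have d1 : Tu * Xx - Tx * Xu = 0 := by linear_combination a2 - a1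
  refine one_ne_zero (α := ℝ) ?_
  have e : (y₁ * Tt + y₂ * Tx + y₃ * Tu) * (w₁ * Xt + w₂ * Xx + w₃ * Xu)
      - (w₁ * Tt + w₂ * Tx + w₃ * Tu) * (y₁ * Xt + y₂ * Xx + y₃ * Xu) = 0 := by
    linear_combination (y₁ * w₂ - y₂ * w₁) * d0 + (y₁ * w₃ - y₃ * w₁) * d2
      + (y₃ * w₂ - y₂ * w₃) * d1
  rw [h1, h2, k1, k2] at e
  linarith

theorem MapsEquation.contDiffOn_fst (H : MapsEquation θ θ' φ D) :
    ContDiffOn ℝ ∞ (fun z => (φ z).1) D := H.isPoint.smooth.fst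

theorem MapsEquation.contDiffOn_snd_fst (H : MapsEquation θ θ' φ D) :
    ContDiffOn ℝ ∞ (fun z => (φ z).2.1) D := H.isPoint.smooth.snd.fst

theorem MapsEquation.contDiffOn_snd_snd (H : MapsEquation θ θ' φ D) :
    ContDiffOn ℝ ∞ (fun z => (φ z).2.2) D := H.isPoint.smooth.snd.snd

theorem MapsEquation.dt_fst_ne_zero (H : MapsEquation θ θ' φ D) {z : VarSpace} (hz : z ∈ D) :
    ∂ₜ (fun z => (φ z).1) z ≠ 0 := by
  intro h0
  obtain ⟨⟨y₁, y₂, y₃⟩, h1, -, -⟩ := H.isPoint.exists_pd_eq hz 1 0 0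
  obtain ⟨hx, hu⟩ := H.pd_time_eq_zero hz
  rw [pd_varSpace, h0, hx, hu] at h1
  simp at h1

/-- The consequence of `MapsEquation.jet` for transformations with `T = T(t)`. Here `Y` is the
total derivative of `X` with respect to `x`, the number `v₂` is the derivative of the transformed
function with respect to `x̃`, and `r` is the value of `u_t` given by the equation. -/
theorem MapsEquation.reduced_jet (H : MapsEquation θ θ' φ D) {z : VarSpace} (hz : z ∈ D)
    {p r c Y v₂ : ℝ} (hY : Y = ∂ₓ (fun z => (φ z).2.1) z + p * ∂ᵤ (fun z => (φ z).2.1) z)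
    (hY0 : Y ≠ 0)
    (hv₂ : v₂ * Y = ∂ₓ (fun z => (φ z).2.2) z + p * ∂ᵤ (fun z => (φ z).2.2) z)
    (hr : r = θ.g z.1 * c - z.2.2 ^ θ.n * p - θ.h z.1 * z.2.2) :
    (∂ₜ (fun z => (φ z).2.2) z + r * ∂ᵤ (fun z => (φ z).2.2) z
        - v₂ * (∂ₜ (fun z => (φ z).2.1) z + r * ∂ᵤ (fun z => (φ z).2.1) z)) * Y ^ 2
      + ∂ₜ (fun z => (φ z).1) z
        * ((φ z).2.2 ^ θ'.n * v₂ + θ'.h (φ z).1 * (φ z).2.2) * Y ^ 2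
      = θ'.g (φ z).1 * ∂ₜ (fun z => (φ z).1) z
        * (pd (0, 1, p) (pd (0, 1, p) fun z => (φ z).2.2) z
          - v₂ * pd (0, 1, p) (pd (0, 1, p) fun z => (φ z).2.1) z
          + (∂ᵤ (fun z => (φ z).2.2) z - v₂ * ∂ᵤ (fun z => (φ z).2.1) z) * c) := by
  have hd := H.isPoint.differentiableAt hz
  have eT : ∀ v, pd v (fun z => (φ z).1) z = (fderiv ℝ φ z v).1 := fderiv_fst_comp hd
  have eX : ∀ v, pd v (fun z => (φ z).2.1) z = (fderiv ℝ φ z v).2.1 := fderiv_snd_fst_comp hd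
  have eU : ∀ v, pd v (fun z => (φ z).2.2) z = (fderiv ℝ φ z v).2.2 := fderiv_snd_snd_comp hd
  have hTt := H.dt_fst_ne_zero hz
  obtain ⟨hTx, hTu⟩ := H.pd_time_eq_zero hz
  have hχT : ∀ y ∈ D, pd (0, 1, p) (fun z => (φ z).1) y = 0 := by
    intro y hy
    rw [pd_zero_one, (H.pd_time_eq_zero hy).1, (H.pd_time_eq_zero hy).2]
    simp
  have hχχT : pd (0, 1, p) (pd (0, 1, p) fun z => (φ z).1) z = 0 :=
    pd_eq_zero_of_eqOn_const H.isPoint.isOpen hχT _ hz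
  have hτT : pd (1, 0, r) (fun z => (φ z).1) z = ∂ₜ (fun z => (φ z).1) z := by
    rw [pd_one_zero, hTu]; simp
  have hτX := pd_one_zero (fun z => (φ z).2.1) z r
  have hτU := pd_one_zero (fun z => (φ z).2.2) z r
  have hχX := pd_zero_one (fun z => (φ z).2.1) z p
  have hχU := pd_zero_one (fun z => (φ z).2.2) z p
  obtain ⟨Tt, hTt'⟩ : ∃ Tt, Tt = ∂ₜ (fun z => (φ z).1) z := ⟨_, rfl⟩
  rw [← hTt'] at hTt hτT ⊢
  obtain ⟨v₁, hv₁⟩ : ∃ v₁, Tt * v₁ = pd (1, 0, r) (fun z => (φ z).2.2) z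
      - v₂ * pd (1, 0, r) (fun z => (φ z).2.1) z := ⟨_, mul_div_cancel₀ _ hTt⟩
  have J := H.jet hz (r := r) (p := p) (a := 0) (b := 0) (c := c) (v₁ := v₁) (v₂ := v₂)
    (Δ := Tt * Y) (ξ₁ := 0) (ξ₂ := Y⁻¹)
    (by rw [← eT, ← eT, ← eX, ← eX, hχT z hz, hτT, hχX, hY]; ring)
    (mul_ne_zero hTt hY0)
    (by rw [← eT, ← eX, ← eU, hτT]; linear_combination -hv₁)
    (by rw [← eT, ← eX, ← eU, hχT z hz, hχU, hχX, ← hv₂, ← hY]; ring)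
    (by rw [← eT, hχT z hz]; simp)
    (by rw [← eT, hτT]; field_simp)
    (by rw [hr]; ring)
  have hw : ((0, Y⁻¹, 0 * r + Y⁻¹ * p) : VarSpace) = Y⁻¹ • (0, 1, p) := by simp
  rw [hw] at J
  simp only [map_smul, _root_.smul_apply, smul_eq_mul] at J
  rw [fderiv_fderiv_apply H.contDiffOn_fst H.isPoint.isOpen _ _ hz,
    fderiv_fderiv_apply H.contDiffOn_snd_fst H.isPoint.isOpen _ _ hz,
    fderiv_fderiv_apply H.contDiffOn_snd_snd H.isPoint.isOpen _ _ hz,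
    ← eT, ← eX, ← eU, hχχT, hTu] at J
  rw [← hτX, ← hτU]
  have hYY : Y * Y⁻¹ = 1 := mul_inv_cancel₀ hY0
  generalize Y⁻¹ = Z at *
  have e : ∀ A : ℝ, A * Y ^ 2 * Z ^ 2 = A := by
    intro A; linear_combination A * (Y * Z + 1) * hYY
  rw [← e (pd (0, 1, p) (pd (0, 1, p) fun z => (φ z).2.2) z
          - v₂ * pd (0, 1, p) (pd (0, 1, p) fun z => (φ z).2.1) z
          + (∂ᵤ (fun z => (φ z).2.2) z - v₂ * ∂ᵤ (fun z => (φ z).2.1) z) * c)]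
  linear_combination Tt * Y ^ 2 * J - Y ^ 2 * hv₁

/-- `X` does not depend on `u`, and the coefficients of `u_xx` match. -/
theorem MapsEquation.pd_space (H : MapsEquation θ θ' φ D) {z : VarSpace} (hz : z ∈ D) :
    ∂ᵤ (fun z => (φ z).2.1) z = 0 ∧ ∂ₓ (fun z => (φ z).2.1) z ≠ 0 ∧
      ∂ᵤ (fun z => (φ z).2.2) z ≠ 0 ∧
      ∂ₓ (fun z => (φ z).2.1) z ^ 2 * θ.g z.1 = θ'.g (φ z).1 * ∂ₜ (fun z => (φ z).1) z := by
  have hTt := H.dt_fst_ne_zero hz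
  obtain ⟨hTx, hTu⟩ := H.pd_time_eq_zero hz
  have hg : θ.g z.1 ≠ 0 := θ.g_ne_zero _ (H.source hz).1
  -- vectors that exclude the degenerate gradients, with vanishing `t`-components since `T = T(t)`
  obtain ⟨⟨y₁, y₂, y₃⟩, h1, h2, -⟩ := H.isPoint.exists_pd_eq hz 0 1 0
  obtain ⟨⟨w₁, w₂, w₃⟩, k1, k2, k3⟩ := H.isPoint.exists_pd_eq hz 0 0 1
  rw [pd_varSpace, hTx, hTu] at h1 k1
  have hy₁ : y₁ = 0 := by simpa [hTt] using h1
  have hw₁ : w₁ = 0 := by simpa [hTt] using k1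
  rw [pd_varSpace, hy₁] at h2
  rw [pd_varSpace, hw₁] at k2 k3
  have key : ∀ p : ℝ, ∂ₓ (fun z => (φ z).2.1) z + p * ∂ᵤ (fun z => (φ z).2.1) z ≠ 0 →
      (∂ₓ (fun z => (φ z).2.1) z + p * ∂ᵤ (fun z => (φ z).2.1) z) ^ 2 * θ.g z.1
        = θ'.g (φ z).1 * ∂ₜ (fun z => (φ z).1) z := by
    intro p hp
    have hv := div_mul_cancel₀ (∂ₓ (fun z => (φ z).2.2) z + p * ∂ᵤ (fun z => (φ z).2.2) z) hp
    -- the coefficient of `c = u_xx`, after `u_t` is eliminated by the source equation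
    have J0 := H.reduced_jet hz (p := p) (c := 0) rfl hp hv rfl
    have J1 := H.reduced_jet hz (p := p) (c := 1) rfl hp hv rfl
    set v₂ := (∂ₓ (fun z => (φ z).2.2) z + p * ∂ᵤ (fun z => (φ z).2.2) z)
      / (∂ₓ (fun z => (φ z).2.1) z + p * ∂ᵤ (fun z => (φ z).2.1) z)
    have hκ : ∂ᵤ (fun z => (φ z).2.2) z - v₂ * ∂ᵤ (fun z => (φ z).2.1) z ≠ 0 := by
      intro h0
      refine one_ne_zero (α := ℝ) ?_
      linear_combination -k3 + v₂ * k2 - w₂ * hv + (w₃ - p * w₂) * h0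
    refine mul_left_cancel₀ hκ ?_
    linear_combination J1 - J0
  have hXu : ∂ᵤ (fun z => (φ z).2.1) z = 0 := by
    by_contra hne
    -- slopes at which the total derivative of `X` with respect to `x` is `1` and `2`
    have e1 := key ((1 - ∂ₓ (fun z => (φ z).2.1) z) / ∂ᵤ (fun z => (φ z).2.1) z)
    have e2 := key ((2 - ∂ₓ (fun z => (φ z).2.1) z) / ∂ᵤ (fun z => (φ z).2.1) z)
    rw [div_mul_cancel₀ _ hne] at e1 e2
    have e1' := e1 (by norm_num)
    have e2' := e2 (by norm_num)
    refine hg ?_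
    linear_combination (e2' - e1') / 3
  rw [hXu] at h2 k2
  have hXx : ∂ₓ (fun z => (φ z).2.1) z ≠ 0 := by
    intro h0
    rw [h0] at h2
    simp at h2
  have hw₂ : w₂ = 0 := by simpa [hXx] using k2
  refine ⟨hXu, hXx, ?_, ?_⟩
  · intro h0
    rw [hw₂, h0] at k3
    simp at k3
  · simpa using key 0 (by simpa using hXx)

end Determining

theorem pd_fst (z v : VarSpace) : pd v (fun z : VarSpace => z.1) z = v.1 :=
  (hasFDerivAt_fst (𝕜 := ℝ) (p := z)).pd_eq v

theorem pd_snd_snd (z v : VarSpace) : pd v (fun z : VarSpace => z.2.2) z = v.2.2 :=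
  (hasFDerivAt_snd (𝕜 := ℝ) (p := z)).snd.pd_eq v

theorem differentiableAt_snd_snd (z : VarSpace) :
    DifferentiableAt ℝ (fun z : VarSpace => z.2.2) z :=
  (hasFDerivAt_snd (𝕜 := ℝ) (p := z)).snd.differentiableAt

theorem pd_pd_zero_one {D : Set VarSpace} (hD : IsOpen D) {F : VarSpace → ℝ}
    (hF : ContDiffOn ℝ ∞ F D) {z : VarSpace} (hz : z ∈ D) (p : ℝ) :
    pd (0, 1, p) (pd (0, 1, p) F) z
      = ∂ₓ (∂ₓ F) z + 2 * p * ∂ₓ (∂ᵤ F) z + p ^ 2 * ∂ᵤ (∂ᵤ F) z := by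
  have e : EqOn (pd (0, 1, p) F) (fun y => ∂ₓ F y + p * ∂ᵤ F y) D := fun y _ => pd_zero_one F y p
  have dx : DifferentiableAt ℝ (∂ₓ F) z :=
    ((hF.pd hD _).hasFDerivAt_of_isOpen hD hz).differentiableAt
  have du : DifferentiableAt ℝ (∂ᵤ F) z :=
    ((hF.pd hD _).hasFDerivAt_of_isOpen hD hz).differentiableAt
  have h : ∀ v, pd v (pd (0, 1, p) F) z = pd v (∂ₓ F) z + p * pd v (∂ᵤ F) z := by
    intro v
    rw [pd_eqOn hD e v hz, pd_add dx (du.const_mul p)]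
    congr 1
    exact ((du.hasFDerivAt.const_mul p).pd_eq v).trans rfl
  rw [pd_zero_one, h, h, pd_comm hF hD (0, 0, 1) (0, 1, 0) hz]
  ring

/-- A power law between functions that are affine in `u`: differentiating three times with respect
to `u` leaves only proportional functions and equal exponents, unless the exponent is one. -/
theorem eq_of_power_relation {D : Set VarSpace} (hD : IsOpen D) {A B C U : VarSpace → ℝ}
    (hA : ContDiffOn ℝ ∞ A D) (hB : ContDiffOn ℝ ∞ B D) (hC : ContDiffOn ℝ ∞ C D)
    (hU : ContDiffOn ℝ ∞ U D) (dA : ∀ z ∈ D, ∂ᵤ A z = 0) (dB : ∀ z ∈ D, ∂ᵤ B z = 0)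
    (dC : ∀ z ∈ D, ∂ᵤ C z = 0) (hUu : ∀ z ∈ D, ∂ᵤ U z ≠ 0) (dU : ∀ z ∈ D, ∂ᵤ (∂ᵤ U) z = 0)
    (hB0 : ∀ z ∈ D, B z ≠ 0) (hU0 : ∀ z ∈ D, 0 < U z) (hu0 : ∀ z ∈ D, 0 < z.2.2) {n m : ℝ}
    (hn0 : n ≠ 0) (hn1 : n ≠ 1) (h : ∀ z ∈ D, A z * U z ^ m = B z * z.2.2 ^ n + C z) :
    ∀ z ∈ D, m = n ∧ U z = ∂ᵤ U z * z.2.2 ∧ C z = 0 := by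
  have dif : ∀ {F : VarSpace → ℝ}, ContDiffOn ℝ ∞ F D → ∀ z ∈ D, DifferentiableAt ℝ F z :=
    fun hF z hz => (hF.hasFDerivAt_of_isOpen hD hz).differentiableAt
  have difU : ∀ r : ℝ, ∀ z ∈ D, DifferentiableAt ℝ (fun y => U y ^ r) z := fun r z hz =>
    (dif hU z hz).rpow_const (Or.inl (hU0 z hz).ne')
  have difu : ∀ r : ℝ, ∀ z ∈ D, DifferentiableAt ℝ (fun y : VarSpace => y.2.2 ^ r) z :=
    fun r z hz => (differentiableAt_snd_snd z).rpow_const (Or.inl (hu0 z hz).ne')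
  have pdu : ∀ r : ℝ, ∀ z ∈ D, ∂ᵤ (fun y : VarSpace => y.2.2 ^ r) z = r * z.2.2 ^ (r - 1) := by
    intro r z hz
    rw [pd_rpow_const (differentiableAt_snd_snd z) (hu0 z hz), pd_snd_snd, mul_one]
  have hα := hU.pd hD (0, 0, 1)
  have step1 : ∀ z ∈ D, A z * ∂ᵤ U z * (m * U z ^ (m - 1)) = B z * (n * z.2.2 ^ (n - 1)) := by
    intro z hz
    have e := pd_eqOn hD (F := fun z => A z * U z ^ m) h (0, 0, 1) hz
    rw [pd_mul_of_eq_zero (dif hA z hz) (difU m z hz) (dA z hz),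
      pd_rpow_const (dif hU z hz) (hU0 z hz), pd_add ((dif hB z hz).fun_mul (difu n z hz)) (dif hC z hz),
      pd_mul_of_eq_zero (dif hB z hz) (difu n z hz) (dB z hz), dC z hz, pdu n z hz] at e
    linear_combination e
  have step2 : ∀ z ∈ D, A z * ∂ᵤ U z ^ 2 * (m * ((m - 1) * U z ^ (m - 1 - 1)))
      = B z * (n * ((n - 1) * z.2.2 ^ (n - 1 - 1))) := by
    intro z hz
    have e := pd_eqOn hD (F := fun z => (A z * ∂ᵤ U z) * (m * U z ^ (m - 1)))
      (G := fun z => B z * (n * z.2.2 ^ (n - 1))) step1 (0, 0, 1) hz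
    have dAU : ∂ᵤ (fun y => A y * ∂ᵤ U y) z = 0 := by
      rw [pd_mul_of_eq_zero (dif hA z hz) (dif hα z hz) (dA z hz), dU z hz, mul_zero]
    have cm : ∀ r : ℝ, ∂ᵤ (fun _ => r) z = 0 := fun r => (hasFDerivAt_const r z).pd_eq _
    rw [pd_mul_of_eq_zero ((dif hA z hz).fun_mul (dif hα z hz)) ((difU _ z hz).const_mul m) dAU,
      pd_mul_of_eq_zero (differentiableAt_const m) (difU _ z hz) (cm m),
      pd_rpow_const (dif hU z hz) (hU0 z hz),
      pd_mul_of_eq_zero (dif hB z hz) ((difu _ z hz).const_mul n) (dB z hz),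
      pd_mul_of_eq_zero (differentiableAt_const n) (difu _ z hz) (cm n), pdu _ z hz] at e
    linear_combination e
  have step3 : ∀ z ∈ D, (m - 1) * ∂ᵤ U z * z.2.2 = (n - 1) * U z := by
    intro z hz
    have e1 := step1 z hz
    have e2 := step2 z hz
    have hu := hu0 z hz
    have rU : U z ^ (m - 1) = U z ^ (m - 1 - 1) * U z := by
      rw [← Real.rpow_add_one (hU0 z hz).ne']; ring_nf
    have ru : z.2.2 ^ (n - 1) = z.2.2 ^ (n - 1 - 1) * z.2.2 := by
      rw [← Real.rpow_add_one hu.ne']; ring_nf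
    have hne : B z * (n * z.2.2 ^ (n - 1)) ≠ 0 :=
      mul_ne_zero (hB0 z hz) (mul_ne_zero hn0 (Real.rpow_pos_of_pos hu _).ne')
    refine mul_left_cancel₀ hne ?_
    -- multiply the second relation by `U u` and compare with the first one
    have e2' : (A z * ∂ᵤ U z * (m * U z ^ (m - 1))) * ((m - 1) * ∂ᵤ U z * z.2.2)
        = (B z * (n * z.2.2 ^ (n - 1))) * ((n - 1) * U z) := by
      rw [rU, ru]
      linear_combination U z * z.2.2 * e2
    rw [e1] at e2'
    exact e2'
  have step4 : ∀ z ∈ D, m = n := by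
    intro z hz
    have e := pd_eqOn hD (F := fun z => ((m - 1) * ∂ᵤ U z) * z.2.2)
      (G := fun z => (n - 1) * U z) step3 (0, 0, 1) hz
    have cm : ∀ r : ℝ, ∂ᵤ (fun _ => r) z = 0 := fun r => (hasFDerivAt_const r z).pd_eq _
    have d0 : ∂ᵤ (fun y => (m - 1) * ∂ᵤ U y) z = 0 := by
      rw [pd_mul_of_eq_zero (differentiableAt_const _) (dif hα z hz) (cm _), dU z hz, mul_zero]
    rw [pd_mul_of_eq_zero ((dif hα z hz).const_mul _) (differentiableAt_snd_snd z) d0,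
      pd_mul_of_eq_zero (differentiableAt_const _) (dif hU z hz) (cm _), pd_snd_snd] at e
    have := mul_right_cancel₀ (hUu z hz) (show (m - 1) * ∂ᵤ U z = (n - 1) * ∂ᵤ U z by
      linear_combination e)
    linarith
  intro z hz
  have hmn := step4 z hz
  have hU1 : U z = ∂ᵤ U z * z.2.2 := by
    refine mul_left_cancel₀ (sub_ne_zero.2 hn1) ?_
    rw [← step3 z hz, hmn]
    ring
  refine ⟨hmn, hU1, ?_⟩
  have e0 := h z hz
  have e1 := step1 z hz
  rw [hmn] at e0 e1
  have rU : U z ^ n = U z ^ (n - 1) * U z := by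
    rw [← Real.rpow_add_one (hU0 z hz).ne']; ring_nf
  have ru : z.2.2 ^ n = z.2.2 ^ (n - 1) * z.2.2 := by
    rw [← Real.rpow_add_one (hu0 z hz).ne']; ring_nf
  rw [rU, ru] at e0
  refine mul_left_cancel₀ (mul_ne_zero hn0 (hUu z hz)) ?_
  linear_combination -n * ∂ᵤ U z * e0 + U z * e1 + B z * n * z.2.2 ^ (n - 1) * hU1

section Determined

variable {θ θ' : GenBurgers} {φ : VarSpace → VarSpace} {D : Set VarSpace}

theorem GenBurgers.differentiableAt_g (θ : GenBurgers) {t : ℝ} (ht : t ∈ θ.I) :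
    DifferentiableAt ℝ θ.g t :=
  (θ.smooth_g.hasFDerivAt_of_isOpen θ.isOpen_I ht).differentiableAt

/-- `X_x` depends on `t` only, since its square is `g'(T) T_t / g`. -/
theorem MapsEquation.dx_dx_space (H : MapsEquation θ θ' φ D) {z : VarSpace} (hz : z ∈ D) :
    ∂ₓ (∂ₓ fun z => (φ z).2.1) z = 0 := by
  have hD := H.isPoint.isOpen
  have dif : ∀ {F : VarSpace → ℝ}, ContDiffOn ℝ ∞ F D → DifferentiableAt ℝ F z :=
    fun hF => (hF.hasFDerivAt_of_isOpen hD hz).differentiableAt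
  have hT := dif H.contDiffOn_fst
  have hτ := dif (H.contDiffOn_fst.pd hD (1, 0, 0))
  have hξ := dif (H.contDiffOn_snd_fst.pd hD (0, 1, 0))
  have hzI := (H.source hz).1
  have hg := θ.differentiableAt_g hzI
  have hg' := θ'.differentiableAt_g (H.target hz).1
  have hgz : DifferentiableAt ℝ (fun z : VarSpace => θ.g z.1) z :=
    DifferentiableAt.comp z hg differentiableAt_fst
  have hgT : DifferentiableAt ℝ (fun z : VarSpace => θ'.g (φ z).1) z :=
    DifferentiableAt.comp (f := fun z : VarSpace => (φ z).1) z hg' hT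
  have e := pd_eqOn hD (F := fun z => (∂ₓ (fun z => (φ z).2.1) z * ∂ₓ (fun z => (φ z).2.1) z)
    * θ.g z.1) (G := fun z => θ'.g (φ z).1 * ∂ₜ (fun z => (φ z).1) z)
    (fun y hy => by simpa [sq] using (H.pd_space hy).2.2.2) (0, 1, 0) hz
  have h1 : ∂ₓ (fun z : VarSpace => θ.g z.1) z = 0 :=
    pd_comp_real_eq_zero (F := fun z : VarSpace => z.1) hg differentiableAt_fst (pd_fst _ _)
  have h2 : ∂ₓ (fun z : VarSpace => θ'.g (φ z).1) z = 0 :=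
    pd_comp_real_eq_zero (F := fun z : VarSpace => (φ z).1) hg' hT (H.pd_time_eq_zero hz).1
  have h3 : ∂ₓ (∂ₜ fun z => (φ z).1) z = 0 := by
    rw [pd_comm H.contDiffOn_fst hD _ _ hz]
    exact pd_eq_zero_of_eqOn_const hD (fun y hy => (H.pd_time_eq_zero hy).1) _ hz
  rw [pd_mul (hξ.fun_mul hξ) hgz, h1, pd_mul hξ hξ, pd_mul hgT hτ, h2, h3] at e
  have hne : 2 * ∂ₓ (fun z => (φ z).2.1) z * θ.g z.1 ≠ 0 :=
    mul_ne_zero (mul_ne_zero two_ne_zero (H.pd_space hz).2.1) (θ.g_ne_zero _ hzI)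
  refine mul_left_cancel₀ hne ?_
  linear_combination e

/-- The coefficients of `u_x ^ 2`, `u_x` and `1` in the determining equation. -/
theorem MapsEquation.coefficients (H : MapsEquation θ θ' φ D) {z : VarSpace} (hz : z ∈ D) :
    ∂ᵤ (∂ᵤ fun z => (φ z).2.2) z = 0 ∧
    ∂ᵤ (fun z => (φ z).2.2) z * ∂ₜ (fun z => (φ z).1) z * (φ z).2.2 ^ θ'.n
      = ∂ᵤ (fun z => (φ z).2.2) z * ∂ₓ (fun z => (φ z).2.1) z * z.2.2 ^ θ.n
        + (∂ᵤ (fun z => (φ z).2.2) z * ∂ₜ (fun z => (φ z).2.1) z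
          + 2 * θ.g z.1 * ∂ₓ (fun z => (φ z).2.1) z * ∂ₓ (∂ᵤ fun z => (φ z).2.2) z) ∧
    ∂ₓ (fun z => (φ z).2.1) z * (∂ₜ (fun z => (φ z).2.2) z
        - θ.h z.1 * z.2.2 * ∂ᵤ (fun z => (φ z).2.2) z)
      - ∂ₓ (fun z => (φ z).2.2) z * ∂ₜ (fun z => (φ z).2.1) z
      + ∂ₜ (fun z => (φ z).1) z * ((φ z).2.2 ^ θ'.n * ∂ₓ (fun z => (φ z).2.2) z
        + θ'.h (φ z).1 * (φ z).2.2 * ∂ₓ (fun z => (φ z).2.1) z)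
      = θ.g z.1 * ∂ₓ (fun z => (φ z).2.1) z * ∂ₓ (∂ₓ fun z => (φ z).2.2) z := by
  have hD := H.isPoint.isOpen
  obtain ⟨hXu, hξ, hα, hg'⟩ := H.pd_space hz
  have hg : θ.g z.1 ≠ 0 := θ.g_ne_zero _ (H.source hz).1
  have hXχ : ∀ p, pd (0, 1, p) (pd (0, 1, p) fun z => (φ z).2.1) z = 0 := by
    intro p
    have h0 : ∀ v, pd v (∂ᵤ fun z => (φ z).2.1) z = 0 := fun v =>
      pd_eq_zero_of_eqOn_const hD (fun y hy => (H.pd_space hy).1) v hz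
    rw [pd_pd_zero_one hD H.contDiffOn_snd_fst hz, H.dx_dx_space hz, h0, h0]
    simp
  have P : ∀ p : ℝ, ∂ₓ (fun z => (φ z).2.1) z * (∂ₜ (fun z => (φ z).2.2) z
        - (z.2.2 ^ θ.n * p + θ.h z.1 * z.2.2) * ∂ᵤ (fun z => (φ z).2.2) z)
      - (∂ₓ (fun z => (φ z).2.2) z + p * ∂ᵤ (fun z => (φ z).2.2) z) * ∂ₜ (fun z => (φ z).2.1) z
      + ∂ₜ (fun z => (φ z).1) z * ((φ z).2.2 ^ θ'.n * (∂ₓ (fun z => (φ z).2.2) z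
          + p * ∂ᵤ (fun z => (φ z).2.2) z)
        + θ'.h (φ z).1 * (φ z).2.2 * ∂ₓ (fun z => (φ z).2.1) z)
      = θ.g z.1 * ∂ₓ (fun z => (φ z).2.1) z * (∂ₓ (∂ₓ fun z => (φ z).2.2) z
        + 2 * p * ∂ₓ (∂ᵤ fun z => (φ z).2.2) z + p ^ 2 * ∂ᵤ (∂ᵤ fun z => (φ z).2.2) z) := by
    intro p
    have hv := div_mul_cancel₀ (∂ₓ (fun z => (φ z).2.2) z + p * ∂ᵤ (fun z => (φ z).2.2) z) hξ
    have hJ := H.reduced_jet hz (p := p) (c := 0)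
      (Y := ∂ₓ (fun z => (φ z).2.1) z) (by rw [hXu]; ring) hξ hv rfl
    rw [hXχ, pd_pd_zero_one hD H.contDiffOn_snd_snd hz p, hXu, ← hg'] at hJ
    generalize (∂ₓ (fun z => (φ z).2.2) z + p * ∂ᵤ (fun z => (φ z).2.2) z)
      / ∂ₓ (fun z => (φ z).2.1) z = v at *
    refine mul_left_cancel₀ (pow_ne_zero 2 hξ) ?_
    rw [← hv]
    linear_combination ∂ₓ (fun z => (φ z).2.1) z * hJ
  have P0 := P 0
  have P1 := P 1
  have P2 := P (-1)
  refine ⟨?_, ?_, ?_⟩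
  · refine mul_left_cancel₀ (mul_ne_zero hg hξ) ?_
    linear_combination P0 - (P1 + P2) / 2
  · linear_combination (P1 - P2) / 2
  · linear_combination P0

/-- Transformations of equations with `n ≠ 1` preserve `n`, and their components are determined up
to constants by `T`. -/
theorem MapsEquation.determined (H : MapsEquation θ θ' φ D) (hn : θ.n ≠ 1) {z : VarSpace}
    (hz : z ∈ D) :
    θ'.n = θ.n ∧ ∂ₜ (fun z => (φ z).2.1) z = 0 ∧ (∀ v, pd v (∂ₓ fun z => (φ z).2.1) z = 0) ∧
    ∂ₜ (fun z => (φ z).1) z * (φ z).2.2 ^ θ.n = ∂ₓ (fun z => (φ z).2.1) z * z.2.2 ^ θ.n ∧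
    θ'.h (φ z).1 = θ.h z.1 / ∂ₜ (fun z => (φ z).1) z
      + ∂ₜ (∂ₜ fun z => (φ z).1) z / (θ.n * ∂ₜ (fun z => (φ z).1) z ^ 2) := by
  have hD := H.isPoint.isOpen
  have sT := H.contDiffOn_fst
  have sX := H.contDiffOn_snd_fst
  have sU := H.contDiffOn_snd_snd
  have sτ := sT.pd hD (1, 0, 0)
  have sξ := sX.pd hD (0, 1, 0)
  have sα := sU.pd hD (0, 0, 1)
  have sXt := sX.pd hD (1, 0, 0)
  have sαx := sα.pd hD (0, 1, 0)
  have sg : ContDiffOn ℝ ∞ (fun z : VarSpace => 2 * θ.g z.1) D :=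
    contDiffOn_const.mul (θ.smooth_g.comp contDiff_fst.contDiffOn fun y hy => (H.source hy).1)
  have dif : ∀ {F : VarSpace → ℝ}, ContDiffOn ℝ ∞ F D → ∀ y ∈ D, DifferentiableAt ℝ F y :=
    fun hF y hy => (hF.hasFDerivAt_of_isOpen hD hy).differentiableAt
  have zT : ∀ y ∈ D, ∀ v : VarSpace, v.1 = 0 → pd v (fun z => (φ z).1) y = 0 := by
    rintro y hy ⟨a, b, c⟩ rfl
    rw [pd_varSpace, (H.pd_time_eq_zero hy).1, (H.pd_time_eq_zero hy).2]; simp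
  have zτ : ∀ y ∈ D, ∀ v : VarSpace, v.1 = 0 → pd v (∂ₜ fun z => (φ z).1) y = 0 := by
    intro y hy v hv
    rw [pd_comm sT hD _ _ hy]
    exact pd_eq_zero_of_eqOn_const hD (fun x hx => zT x hx v hv) _ hy
  have zXu : ∀ y ∈ D, ∀ v, ∂ᵤ (pd v fun z => (φ z).2.1) y = 0 := by
    intro y hy v
    rw [pd_comm sX hD _ _ hy]
    exact pd_eq_zero_of_eqOn_const hD (fun x hx => (H.pd_space hx).1) _ hy
  have zα : ∀ y ∈ D, ∂ᵤ (∂ᵤ fun z => (φ z).2.2) y = 0 := fun y hy => (H.coefficients hy).1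
  have zαx : ∀ y ∈ D, ∂ᵤ (∂ₓ (∂ᵤ fun z => (φ z).2.2)) y = 0 := by
    intro y hy
    rw [pd_comm sα hD _ _ hy]
    exact pd_eq_zero_of_eqOn_const hD zα _ hy
  have zg : ∀ y ∈ D, ∂ᵤ (fun z : VarSpace => 2 * θ.g z.1) y = 0 := by
    intro y hy
    exact pd_comp_real_eq_zero (f := fun s => 2 * θ.g s) (F := fun z : VarSpace => z.1)
      ((θ.differentiableAt_g (H.source hy).1).const_mul 2) differentiableAt_fst (pd_fst _ _)
  have zmul : ∀ {F G : VarSpace → ℝ}, ContDiffOn ℝ ∞ F D → ContDiffOn ℝ ∞ G D →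
      (∀ y ∈ D, ∂ᵤ F y = 0) → (∀ y ∈ D, ∂ᵤ G y = 0) → ∀ y ∈ D, ∂ᵤ (fun x => F x * G x) y = 0 := by
    intro F G hF hG h1 h2 y hy
    rw [pd_mul_of_eq_zero (dif hF y hy) (dif hG y hy) (h1 y hy), h2 y hy, mul_zero]
  have key := eq_of_power_relation hD (sα.mul sτ) (sα.mul sξ)
    ((sα.mul sXt).add ((sg.mul sξ).mul sαx)) sU
    (zmul sα sτ zα fun y hy => zτ y hy _ rfl)
    (zmul sα sξ zα fun y hy => zXu y hy _)
    (fun y hy => by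
      refine (pd_add ((dif sα y hy).mul (dif sXt y hy))
        (((dif sg y hy).mul (dif sξ y hy)).mul (dif sαx y hy)) _).trans ?_
      have h1 := zmul sα sXt zα (fun y hy => zXu y hy _) y hy
      have h2 := zmul (sg.mul sξ) sαx (zmul sg sξ zg fun y hy => zXu y hy _) zαx y hy
      exact (congrArg₂ (· + ·) h1 h2).trans (add_zero 0))
    (fun y hy => (H.pd_space hy).2.2.1) zα
    (fun y hy => mul_ne_zero (H.pd_space hy).2.2.1 (H.pd_space hy).2.1)
    (fun y hy => (H.target hy).2) (fun y hy => (H.source hy).2) θ.n_ne_zero hn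
    (fun y hy => (H.coefficients hy).2.1)
  have hpow : ∀ y ∈ D, ∂ₜ (fun z => (φ z).1) y * (φ y).2.2 ^ θ.n
      = ∂ₓ (fun z => (φ z).2.1) y * y.2.2 ^ θ.n := by
    intro y hy
    obtain ⟨h1, -, h3⟩ := key y hy
    have h4 := (H.coefficients hy).2.1
    rw [h1] at h4
    refine mul_left_cancel₀ (H.pd_space hy).2.2.1 ?_
    have h3' : ∂ᵤ (fun z => (φ z).2.2) y * ∂ₜ (fun z => (φ z).2.1) y
          + 2 * θ.g y.1 * ∂ₓ (fun z => (φ z).2.1) y * ∂ₓ (∂ᵤ fun z => (φ z).2.2) y = 0 := h3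
    linear_combination h4 + h3'
  have hUpos : ∀ y ∈ D, 0 < (φ y).2.2 := fun y hy => (H.target hy).2
  have hupos : ∀ y ∈ D, 0 < y.2.2 := fun y hy => (H.source hy).2
  have dUn : ∀ y ∈ D, DifferentiableAt ℝ (fun z => (φ z).2.2 ^ θ.n) y := fun y hy =>
    (dif sU y hy).rpow_const (Or.inl (hUpos y hy).ne')
  have dun : ∀ y ∈ D, DifferentiableAt ℝ (fun z : VarSpace => z.2.2 ^ θ.n) y := fun y hy =>
    (differentiableAt_snd_snd y).rpow_const (Or.inl (hupos y hy).ne')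
  have rU : ∀ y ∈ D, (φ y).2.2 ^ θ.n = (φ y).2.2 ^ (θ.n - 1) * (φ y).2.2 := by
    intro y hy
    rw [← Real.rpow_add_one (hUpos y hy).ne']; ring_nf
  -- logarithmic derivative of the power law in a direction `v` with vanishing `u`-component
  have hlog : ∀ y ∈ D, ∀ v : VarSpace, v.2.2 = 0 → pd v (∂ₓ fun z => (φ z).2.1) y = 0 →
      pd v (∂ₜ fun z => (φ z).1) y * (φ y).2.2
        + ∂ₜ (fun z => (φ z).1) y * θ.n * pd v (fun z => (φ z).2.2) y = 0 := by
    intro y hy v hv hξv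
    have e := pd_eqOn hD (F := fun y => ∂ₜ (fun z => (φ z).1) y * (φ y).2.2 ^ θ.n)
      (G := fun y => ∂ₓ (fun z => (φ z).2.1) y * y.2.2 ^ θ.n) hpow v hy
    rw [pd_mul (dif sτ y hy) (dUn y hy), pd_mul_of_eq_zero (dif sξ y hy) (dun y hy) hξv,
      pd_rpow_const (dif sU y hy) (hUpos y hy),
      pd_rpow_const (differentiableAt_snd_snd y) (hupos y hy), pd_snd_snd, hv, rU y hy] at e
    refine mul_left_cancel₀ (Real.rpow_pos_of_pos (hUpos y hy) (θ.n - 1)).ne' ?_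
    linear_combination e
  have hUx : ∀ y ∈ D, ∂ₓ (fun z => (φ z).2.2) y = 0 := by
    intro y hy
    have := hlog y hy (0, 1, 0) rfl (H.dx_dx_space hy)
    rw [zτ y hy _ rfl, zero_mul, zero_add] at this
    exact (mul_eq_zero.1 this).resolve_left (mul_ne_zero (H.dt_fst_ne_zero hy) θ.n_ne_zero)
  have hXt : ∀ y ∈ D, ∂ₜ (fun z => (φ z).2.1) y = 0 := by
    intro y hy
    have hαx : ∂ₓ (∂ᵤ fun z => (φ z).2.2) y = 0 := by
      rw [pd_comm sU hD _ _ hy]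
      exact pd_eq_zero_of_eqOn_const hD hUx _ hy
    have h3 : ∂ᵤ (fun z => (φ z).2.2) y * ∂ₜ (fun z => (φ z).2.1) y
          + 2 * θ.g y.1 * ∂ₓ (fun z => (φ z).2.1) y * ∂ₓ (∂ᵤ fun z => (φ z).2.2) y = 0 :=
      (key y hy).2.2
    rw [hαx, mul_zero, add_zero] at h3
    exact (mul_eq_zero.1 h3).resolve_left (H.pd_space hy).2.2.1
  have hξ : ∀ v, pd v (∂ₓ fun z => (φ z).2.1) z = 0 := by
    rintro ⟨a, b, c⟩
    have h1 : ∂ₜ (∂ₓ fun z => (φ z).2.1) z = 0 := by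
      rw [pd_comm sX hD _ _ hz]
      exact pd_eq_zero_of_eqOn_const hD hXt _ hz
    rw [pd_varSpace, h1, H.dx_dx_space hz, zXu z hz]
    simp
  refine ⟨(key z hz).1, hXt z hz, hξ, hpow z hz, ?_⟩
  have hUxx : ∂ₓ (∂ₓ fun z => (φ z).2.2) z = 0 := pd_eq_zero_of_eqOn_const hD hUx _ hz
  have e := (H.coefficients hz).2.2
  rw [hUxx, hUx z hz, hXt z hz] at e
  have l := hlog z hz (1, 0, 0) rfl (hξ _)
  have hU1 : (φ z).2.2 = ∂ᵤ (fun z => (φ z).2.2) z * z.2.2 := (key z hz).2.1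
  have hτ0 := H.dt_fst_ne_zero hz
  have hξ0 := (H.pd_space hz).2.1
  have hn0 := θ.n_ne_zero
  have hU0 := (hUpos z hz).ne'
  have e' : ∂ₜ (fun z => (φ z).2.2) z - θ.h z.1 * (φ z).2.2
      + ∂ₜ (fun z => (φ z).1) z * (θ'.h (φ z).1 * (φ z).2.2) = 0 := by
    refine mul_left_cancel₀ hξ0 ?_
    linear_combination e - θ.h z.1 * ∂ₓ (fun z => (φ z).2.1) z * hU1
  field_simp
  refine mul_left_cancel₀ hU0 ?_
  linear_combination ∂ₜ (fun z => (φ z).1) z * θ.n * e' - l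

end Determined

/-! ### Functions of `t` -/

theorem injOn_of_deriv_ne_zero {J : Set ℝ} (hJ : J.OrdConnected) {f f' : ℝ → ℝ}
    (hf : ∀ t ∈ J, HasDerivAt f (f' t) t) (h0 : ∀ t ∈ J, f' t ≠ 0) : InjOn f J := by
  have key : ∀ a ∈ J, ∀ b ∈ J, a < b → f a ≠ f b := by
    intro a ha b hb hab h
    obtain ⟨c, hc, hc0⟩ := exists_hasDerivAt_eq_zero hab
      (fun t ht => (hf t (hJ.out ha hb ht)).continuousAt.continuousWithinAt) h
      (fun t ht => hf t (hJ.out ha hb (Ioo_subset_Icc_self ht)))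
    exact h0 c (hJ.out ha hb (Ioo_subset_Icc_self hc)) hc0
  intro a ha b hb h
  rcases lt_trichotomy a b with hab | hab | hab
  · exact absurd h (key a ha b hb hab)
  · exact hab
  · exact absurd h.symm (key b hb a ha hab)

/-- A smooth function with nonvanishing derivative on an open interval maps it onto an open
interval and has a smooth inverse there. -/
theorem exists_smooth_inverse {J : Set ℝ} (hJ : IsOpen J) (hJc : IsConnected J) {f : ℝ → ℝ}
    (hf : ContDiffOn ℝ ∞ f J) (h0 : ∀ t ∈ J, deriv f t ≠ 0) :
    IsOpen (f '' J) ∧ IsConnected (f '' J) ∧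
      ∃ ψ : ℝ → ℝ, ContDiffOn ℝ ∞ ψ (f '' J) ∧ MapsTo ψ (f '' J) J ∧ ∀ t ∈ J, ψ (f t) = t := by
  have hd : ∀ t ∈ J, HasDerivAt f (deriv f t) t := fun t ht =>
    ((hf.hasFDerivAt_of_isOpen hJ ht).differentiableAt).hasDerivAt
  have hinj : InjOn f J := injOn_of_deriv_ne_zero hJc.isPreconnected.ordConnected hd h0
  have hleft : ∀ t ∈ J, Function.invFunOn f J (f t) = t := fun t ht => hinj.leftInvOn_invFunOn ht
  have hloc : ∀ t ∈ J, f '' J ∈ 𝓝 (f t) ∧ ContDiffAt ℝ ∞ (Function.invFunOn f J) (f t) := by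
    intro t ht
    have hft : ContDiffAt ℝ ∞ f t := hf.contDiffAt (hJ.mem_nhds ht)
    let e : ℝ ≃L[ℝ] ℝ := ContinuousLinearEquiv.unitsEquivAut ℝ (Units.mk0 (deriv f t) (h0 t ht))
    have he : HasFDerivAt f (e : ℝ →L[ℝ] ℝ) t := by
      have h1 : (e : ℝ →L[ℝ] ℝ) = ContinuousLinearMap.toSpanSingleton ℝ (deriv f t) := by
        ext; simp [e]
      rw [h1]
      exact (hd t ht).hasFDerivAt
    have hψ := hft.to_localInverse he (by simp)
    have hψt : hft.localInverse he (by simp) (f t) = t := hft.localInverse_apply_image he (by simp)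
    have hr : ∀ᶠ s in 𝓝 (f t), f (hft.localInverse he (by simp) s) = s :=
      (hft.hasStrictFDerivAt' he (by simp)).eventually_right_inverse
    have hm : ∀ᶠ s in 𝓝 (f t), hft.localInverse he (by simp) s ∈ J := by
      refine hψ.continuousAt.eventually_mem ?_
      rw [hψt]
      exact hJ.mem_nhds ht
    constructor
    · filter_upwards [hr, hm] with s h1 h2
      exact ⟨_, h2, h1⟩
    · refine hψ.congr_of_eventuallyEq ?_
      filter_upwards [hr, hm] with s h1 h2
      conv_lhs => rw [← h1]
      exact hleft _ h2
  refine ⟨?_, hJc.image f fun t ht => (hd t ht).continuousAt.continuousWithinAt,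
    Function.invFunOn f J, ?_, ?_, hleft⟩
  · rw [isOpen_iff_mem_nhds]
    rintro _ ⟨t, ht, rfl⟩
    exact (hloc t ht).1
  · rintro _ ⟨t, ht, rfl⟩
    exact (hloc t ht).2.contDiffWithinAt
  · rintro _ ⟨t, ht, rfl⟩
    rw [hleft t ht]
    exact ht

/-! ### Mapping equations by the transformations with the parameters `δ₁`, `δ₀` and `T` -/

theorem hasDerivAt_deriv_of_contDiffOn {J : Set ℝ} (hJ : IsOpen J) {f : ℝ → ℝ}
    (hf : ContDiffOn ℝ ∞ f J) {t : ℝ} (ht : t ∈ J) :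
    HasDerivAt f (deriv f t) t ∧ HasDerivAt (deriv f) (deriv (deriv f) t) t :=
  ⟨((hf.hasFDerivAt_of_isOpen hJ ht).differentiableAt).hasDerivAt,
    (((hf.deriv_of_isOpen hJ (m := ∞) (by simp)).hasFDerivAt_of_isOpen hJ
      ht).differentiableAt).hasDerivAt⟩

theorem deriv_comp_affine (F : ℝ → ℝ) (a b y : ℝ) :
    deriv (fun y => F (a * y + b)) y = a * deriv F (a * y + b) := by
  have := deriv_comp_mul_left a (fun s => F (s + b)) y
  rw [deriv_comp_add_const] at this
  simpa using this

/-- The derivative of the multiplier `(δ₁ / T_t) ^ (1 / n)` of `u`. -/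
theorem hasDerivAt_multiplier {f' : ℝ → ℝ} {f'' t δ n : ℝ} (h : HasDerivAt f' f'' t)
    (hpos : 0 < δ * f' t) :
    HasDerivAt (fun s => (δ / f' s) ^ (1 / n)) (-((δ / f' t) ^ (1 / n) * f'' / (n * f' t))) t := by
  have hf0 : f' t ≠ 0 := right_ne_zero_of_mul hpos.ne'
  have hδ0 : δ ≠ 0 := left_ne_zero_of_mul hpos.ne'
  have hb : 0 < δ / f' t := by
    have : δ / f' t = δ * f' t / f' t ^ 2 := by field_simp
    rw [this]
    positivity
  have h1 := ((hasDerivAt_const t δ).div h hf0).rpow_const (p := 1 / n) (Or.inl hb.ne')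
  refine h1.congr_deriv ?_
  have h2 : (δ / f' t) ^ (1 / n - 1) = (δ / f' t) ^ (1 / n) / (δ / f' t) :=
    Real.rpow_sub_one hb.ne' _
  simp only [Pi.div_apply]
  rw [h2]
  by_cases hn : n = 0
  · simp [hn]
  · field_simp
    ring

/-- The chain rule computation. The target equation is the source equation multiplied by
`(δ₁ / T_t) ^ (1 / n) / T_t`. -/
theorem mapsEquation_of_time {θ θ' : GenBurgers} {D : Set VarSpace} (hD : IsOpen D)
    (hDc : IsConnected D) (hDb : D ⊆ θ.base) {f : ℝ → ℝ} {δ₁ δ₀ : ℝ}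
    (hf : ContDiffOn ℝ ∞ f (Prod.fst '' D)) (hpos : ∀ t ∈ Prod.fst '' D, 0 < δ₁ * deriv f t)
    (hI : MapsTo f (Prod.fst '' D) θ'.I) (hn : θ'.n = θ.n)
    (hh : ∀ t ∈ Prod.fst '' D, θ'.h (f t)
      = θ.h t / deriv f t + deriv (deriv f) t / (θ.n * deriv f t ^ 2))
    (hg : ∀ t ∈ Prod.fst '' D, θ'.g (f t) = δ₁ ^ 2 / deriv f t * θ.g t)
    {φ : VarSpace → VarSpace}
    (hφ : ∀ z ∈ D, φ z = (f z.1, δ₁ * z.2.1 + δ₀, (δ₁ / deriv f z.1) ^ (1 / θ.n) * z.2.2)) :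
    MapsEquation θ θ' φ D := by
  have hJ : IsOpen (Prod.fst '' D) := isOpenMap_fst D hD
  have hn0 := θ.n_ne_zero
  have hder := fun t ht => hasDerivAt_deriv_of_contDiffOn hJ hf (t := t) ht
  have hf0 : ∀ t ∈ Prod.fst '' D, deriv f t ≠ 0 := fun t ht => right_ne_zero_of_mul (hpos t ht).ne'
  have hδ0 : δ₁ ≠ 0 := by
    obtain ⟨z, hz⟩ := hDc.nonempty
    exact left_ne_zero_of_mul (hpos z.1 ⟨z, hz, rfl⟩).ne'
  have hb : ∀ t ∈ Prod.fst '' D, 0 < δ₁ / deriv f t := by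
    intro t ht
    have h1 := hpos t ht
    have h2 := hf0 t ht
    have : δ₁ / deriv f t = δ₁ * deriv f t / deriv f t ^ 2 := by field_simp
    rw [this]
    positivity
  have hc : ∀ t ∈ Prod.fst '' D, 0 < (δ₁ / deriv f t) ^ (1 / θ.n) := fun t ht =>
    Real.rpow_pos_of_pos (hb t ht) _
  have hmem : ∀ z ∈ D, z.1 ∈ Prod.fst '' D := fun z hz => ⟨z, hz, rfl⟩
  refine ⟨⟨hD, hDc, ?_, ?_⟩, hDb, ?_, ?_⟩
  · refine ContDiffOn.congr ?_ hφ
    have s1 : ContDiffOn ℝ ∞ (fun z : VarSpace => f z.1) D :=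
      hf.comp contDiff_fst.contDiffOn hmem
    have s2 : ContDiffOn ℝ ∞ (fun z : VarSpace => deriv f z.1) D :=
      (hf.deriv_of_isOpen hJ (m := ∞) (by simp)).comp contDiff_fst.contDiffOn hmem
    have s3 : ContDiffOn ℝ ∞ (fun z : VarSpace => (δ₁ / deriv f z.1) ^ (1 / θ.n)) D :=
      (contDiffOn_const.div s2 fun z hz => hf0 _ (hmem z hz)).rpow_const_of_ne
        fun z hz => (hb _ (hmem z hz)).ne'
    exact s1.prodMk (ContDiffOn.prodMk (by fun_prop) (s3.mul (by fun_prop)))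
  · intro z hz
    refine ContinuousLinearMap.det_ne_zero_of_injective ?_
    have ht := hmem z hz
    have hev : φ =ᶠ[𝓝 z] fun z => (f z.1, δ₁ * z.2.1 + δ₀,
        (δ₁ / deriv f z.1) ^ (1 / θ.n) * z.2.2) := by
      filter_upwards [hD.mem_nhds hz] with y hy using hφ y hy
    have d1 := (hder _ ht).1.hasFDerivAt.comp z (hasFDerivAt_fst (𝕜 := ℝ) (p := z))
    have d2 := ((hasFDerivAt_snd (𝕜 := ℝ) (p := z)).fst.const_mul δ₁).add_const δ₀
    have d3 := ((hasDerivAt_multiplier (n := θ.n) (hder _ ht).2 (hpos _ ht)).hasFDerivAt.comp z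
      (hasFDerivAt_fst (𝕜 := ℝ) (p := z))).mul (hasFDerivAt_snd (𝕜 := ℝ) (p := z)).snd
    have d := (d1.prodMk (d2.prodMk d3)).congr_of_eventuallyEq hev
    rw [d.fderiv]
    rintro ⟨a, b, c⟩ h
    simp only [Prod.ext_iff] at h
    simp [hf0 _ ht, hδ0] at h
    obtain ⟨h1, h2, h3⟩ := h
    subst h1
    have hc0 := (hc _ ht).ne'
    rw [one_div] at hc0
    simp [hc0] at h3
    simp [h2, h3]
  · intro z hz
    rw [hφ z hz]
    exact ⟨hI (hmem z hz), mul_pos (hc _ (hmem z hz)) (hDb hz).2⟩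
  · intro u v q hq hv
    have ht : q.1 ∈ Prod.fst '' D := hmem _ hq
    have hu0 : 0 < u q := (hDb hq).2
    have hcont : Filter.Tendsto (fun p : ℝ × ℝ => ((p.1, p.2, u p) : VarSpace)) (𝓝 q)
        (𝓝 (q.1, q.2, u q)) :=
      (continuousAt_fst.prodMk (continuousAt_snd.prodMk hv.smooth_source.continuousAt))
    have hgr : ∀ᶠ p in 𝓝 q, v (f p.1, δ₁ * p.2 + δ₀)
        = (δ₁ / deriv f p.1) ^ (1 / θ.n) * u p := by
      filter_upwards [hv.graph, hcont.eventually (hD.mem_nhds hq)] with p h1 h2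
      have h3 := hφ _ h2
      simp only [baseMap, h3] at h1
      exact h1
    have hB : baseMap φ u q = (f q.1, δ₁ * q.2 + δ₀) := by
      simp only [baseMap, hφ _ hq]
    have hvs := hv.smooth_target
    unfold GenBurgers.HoldsAt
    rw [hB] at hvs ⊢
    simp only
    have hft := hf0 _ ht
    obtain ⟨df, ddf⟩ := hder _ ht
    have dc := hasDerivAt_multiplier (n := θ.n) ddf (hpos _ ht)
    have hcn : ((δ₁ / deriv f q.1) ^ (1 / θ.n)) ^ θ.n = δ₁ / deriv f q.1 := by
      rw [← Real.rpow_mul (hb _ ht).le, one_div_mul_cancel hn0, Real.rpow_one]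
    -- the derivative with respect to `t`
    have et : deriv (fun s => v (s, δ₁ * q.2 + δ₀)) (f q.1) * deriv f q.1
        = -((δ₁ / deriv f q.1) ^ (1 / θ.n) * deriv (deriv f) q.1 / (θ.n * deriv f q.1)) * u q
          + (δ₁ / deriv f q.1) ^ (1 / θ.n) * deriv (fun s => u (s, q.2)) q.1 := by
      have k1 : HasDerivAt (fun s => v (s, δ₁ * q.2 + δ₀))
          (deriv (fun s => v (s, δ₁ * q.2 + δ₀)) (f q.1)) (f q.1) :=
        (hasDerivAt_comp_curve (F := v) (γ := fun s => (s, δ₁ * q.2 + δ₀))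
          (hvs.differentiableAt (by simp))
          ((hasDerivAt_id _).prodMk (hasDerivAt_const _ _))).differentiableAt.hasDerivAt
      have k2 : HasDerivAt (fun s => u (s, q.2)) (deriv (fun s => u (s, q.2)) q.1) q.1 :=
        (hasDerivAt_comp_curve (F := u) (γ := fun s => (s, q.2))
          (hv.smooth_source.differentiableAt (by simp))
          ((hasDerivAt_id _).prodMk (hasDerivAt_const _ _))).differentiableAt.hasDerivAt
      have hl : ContinuousAt (fun s : ℝ => ((s, q.2) : ℝ × ℝ)) q.1 := by fun_prop
      have k3 : (fun s => v (f s, δ₁ * q.2 + δ₀)) =ᶠ[𝓝 q.1]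
          fun s => (δ₁ / deriv f s) ^ (1 / θ.n) * u (s, q.2) :=
        hl.tendsto.eventually hgr
      exact (k1.comp q.1 df).unique ((dc.mul k2).congr_of_eventuallyEq k3)
    -- the derivatives with respect to `x`
    have hl : ContinuousAt (fun y : ℝ => ((q.1, y) : ℝ × ℝ)) q.2 := by fun_prop
    have kx : (fun y => v (f q.1, δ₁ * y + δ₀)) =ᶠ[𝓝 q.2]
        fun y => (δ₁ / deriv f q.1) ^ (1 / θ.n) * u (q.1, y) :=
      hl.tendsto.eventually hgr
    have kx' := kx.deriv
    have e1 : deriv (fun y => v (f q.1, δ₁ * y + δ₀))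
        = fun y => δ₁ * deriv (fun y => v (f q.1, y)) (δ₁ * y + δ₀) := by
      funext y
      exact deriv_comp_affine (fun y => v (f q.1, y)) δ₁ δ₀ y
    have e2 : deriv (fun y => (δ₁ / deriv f q.1) ^ (1 / θ.n) * u (q.1, y))
        = fun y => (δ₁ / deriv f q.1) ^ (1 / θ.n) * deriv (fun y => u (q.1, y)) y := by
      funext y
      exact deriv_const_mul_field _
    rw [e1, e2] at kx'
    have ex := kx'.self_of_nhds
    beta_reduce at ex
    have exx := kx'.deriv_eq
    rw [deriv_const_mul_field, deriv_const_mul_field,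
      deriv_comp_affine (deriv fun y => v (f q.1, y))] at exx
    have hvq := hgr.self_of_nhds
    rw [hvq, hn, Real.mul_rpow (hc _ ht).le hu0.le, hcn, hh _ ht, hg _ ht]
    have hc0 := (hc _ ht).ne'
    generalize (δ₁ / deriv f q.1) ^ (1 / θ.n) = C at *
    generalize deriv (fun s => v (s, δ₁ * q.2 + δ₀)) (f q.1) = V1 at *
    generalize deriv (fun y => v (f q.1, y)) (δ₁ * q.2 + δ₀) = V2 at *
    generalize deriv (deriv fun y => v (f q.1, y)) (δ₁ * q.2 + δ₀) = V22 at *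
    generalize deriv (fun s => u (s, q.2)) q.1 = u1 at *
    generalize deriv (fun y => u (q.1, y)) q.2 = u2 at *
    generalize deriv (deriv fun y => u (q.1, y)) q.2 = u22 at *
    generalize deriv (deriv f) q.1 = f2 at *
    generalize deriv f q.1 = f1 at *
    generalize u q ^ θ.n = un at *
    have hfac : V1 + δ₁ / f1 * un * V2 + (θ.h q.1 / f1 + f2 / (θ.n * f1 ^ 2)) * (C * u q)
        - δ₁ ^ 2 / f1 * θ.g q.1 * V22
        = C / f1 * (u1 + un * u2 + θ.h q.1 * u q - θ.g q.1 * u22) := by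
      have et' : V1 = (-(C * f2 / (θ.n * f1)) * u q + C * u1) / f1 := by
        rw [eq_div_iff hft, et]
      rw [et']
      field_simp
      linear_combination θ.n * f1 * un * ex - θ.n * f1 * θ.g q.1 * exx
    rw [← sub_eq_zero, ← sub_eq_zero (a := V1 + _ + _), hfac, mul_eq_zero,
      or_iff_right (div_ne_zero hc0 hft)]

/-! ### Equivalence transformations of the joint space -/

/-- The projection of the joint space to `(n, t)`. -/
def projNT : JointSpace →L[ℝ] ℝ × ℝ :=
  ((ContinuousLinearMap.snd ℝ ℝ ℝ).comp
    ((ContinuousLinearMap.snd ℝ ℝ (ℝ × ℝ)).comp (ContinuousLinearMap.snd ℝ VarSpace ElemSpace))).prod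
  ((ContinuousLinearMap.fst ℝ ℝ (ℝ × ℝ)).comp (ContinuousLinearMap.fst ℝ VarSpace ElemSpace))

@[simp] theorem projNT_apply (w : JointSpace) : projNT w = (w.2.2.2, w.1.1) := rfl

theorem isOpenMap_projNT : IsOpenMap (fun w : JointSpace => (w.2.2.2, w.1.1)) := by
  refine projNT.isOpenMap fun y => ⟨((y.2, 0, 0), (0, 0, y.1)), rfl⟩

/-- A map of the joint space that is affine on the fibers over `(n, t)` with invertible
coefficients, and projects to a map `(n, t) ↦ (n, τ)` with `∂τ/∂t ≠ 0`, has a nonvanishing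
Jacobian. -/
theorem det_fderiv_ne_zero_of_fibered {Ψ : JointSpace → JointSpace} {w : JointSpace}
    {τ d₁ d₀ c a b e : ℝ × ℝ → ℝ} (hτ : DifferentiableAt ℝ τ (projNT w))
    (hd₁ : DifferentiableAt ℝ d₁ (projNT w)) (hd₀ : DifferentiableAt ℝ d₀ (projNT w))
    (hc : DifferentiableAt ℝ c (projNT w)) (ha : DifferentiableAt ℝ a (projNT w))
    (hb : DifferentiableAt ℝ b (projNT w)) (he : DifferentiableAt ℝ e (projNT w))
    (hτ0 : fderiv ℝ τ (projNT w) (0, 1) ≠ 0) (hd₁0 : d₁ (projNT w) ≠ 0) (hc0 : c (projNT w) ≠ 0)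
    (ha0 : a (projNT w) ≠ 0) (he0 : e (projNT w) ≠ 0)
    (hΨ : Ψ =ᶠ[𝓝 w] fun w => ((τ (projNT w), d₁ (projNT w) * w.1.2.1 + d₀ (projNT w),
      c (projNT w) * w.1.2.2), (a (projNT w) * w.2.1 + b (projNT w), e (projNT w) * w.2.2.1,
      w.2.2.2))) : (fderiv ℝ Ψ w).det ≠ 0 := by
  refine ContinuousLinearMap.det_ne_zero_of_injective ?_
  have lift : ∀ {f : ℝ × ℝ → ℝ}, DifferentiableAt ℝ f (projNT w) →
      HasFDerivAt (fun w => f (projNT w)) ((fderiv ℝ f (projNT w)).comp projNT) w :=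
    fun hf => hf.hasFDerivAt.comp w projNT.hasFDerivAt
  have p1 := hasFDerivAt_fst (𝕜 := ℝ) (p := w)
  have p2 := hasFDerivAt_snd (𝕜 := ℝ) (p := w)
  have d := (((lift hτ).prodMk ((((lift hd₁).mul p1.snd.fst).add (lift hd₀)).prodMk
    ((lift hc).mul p1.snd.snd))).prodMk ((((lift ha).mul p2.fst).add (lift hb)).prodMk
    (((lift he).mul p2.snd.fst).prodMk p2.snd.snd))).congr_of_eventuallyEq hΨ
  rw [d.fderiv]
  rintro ⟨⟨vt, vx, vu⟩, ⟨vh, vg, vn⟩⟩ h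
  simp only [Prod.ext_iff] at h
  simp only [ContinuousLinearMap.prod_apply, ContinuousLinearMap.comp_apply, projNT_apply,
    Prod.fst_zero, Prod.snd_zero, ContinuousLinearMap.coe_snd', ContinuousLinearMap.coe_fst',
    _root_.add_apply, _root_.smul_apply, smul_eq_mul] at h
  obtain ⟨⟨h1, h2, h3⟩, ⟨h4, h5, h6⟩⟩ := h
  subst h6
  have hz : ∀ s : ℝ, ((0, s) : ℝ × ℝ) = s • (0, 1) := by intro s; simp
  rw [hz, map_smul, smul_eq_mul] at h1
  have hvt : vt = 0 := (mul_eq_zero.1 h1).resolve_right hτ0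
  subst hvt
  have h00 : ((0, 0) : ℝ × ℝ) = 0 := rfl
  simp only [h00, map_zero, mul_zero, add_zero] at h2 h3 h4 h5
  have e2 : vx = 0 := (mul_eq_zero.1 h2).resolve_left hd₁0
  have e3 : vu = 0 := (mul_eq_zero.1 h3).resolve_left hc0
  have e4 : vh = 0 := (mul_eq_zero.1 h4).resolve_left ha0
  have e5 : vg = 0 := (mul_eq_zero.1 h5).resolve_left he0
  rw [e2, e3, e4, e5]
  rfl

/-- The image of an equation under the transformation with the parameters `δ₁` and `f = T(t)`. -/
theorem exists_target (θ : GenBurgers) {J : Set ℝ} (hJ : IsOpen J) (hJc : IsConnected J)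
    (hJI : J ⊆ θ.I) {f : ℝ → ℝ} {δ₁ : ℝ} (hf : ContDiffOn ℝ ∞ f J)
    (hpos : ∀ t ∈ J, 0 < δ₁ * deriv f t) : ∃ θ' : GenBurgers, θ'.n = θ.n ∧ MapsTo f J θ'.I ∧
      (∀ t ∈ J, θ'.h (f t) = θ.h t / deriv f t + deriv (deriv f) t / (θ.n * deriv f t ^ 2)) ∧
      ∀ t ∈ J, θ'.g (f t) = δ₁ ^ 2 / deriv f t * θ.g t := by
  have hf0 : ∀ t ∈ J, deriv f t ≠ 0 := fun t ht => right_ne_zero_of_mul (hpos t ht).ne'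
  obtain ⟨hI, hIc, ψ, hψ, hψJ, hψf⟩ := exists_smooth_inverse hJ hJc hf hf0
  have s1 : ContDiffOn ℝ ∞ (deriv f) J := hf.deriv_of_isOpen hJ (by simp)
  have s2 : ContDiffOn ℝ ∞ (deriv (deriv f)) J := s1.deriv_of_isOpen hJ (by simp)
  refine ⟨{
    I := f '' J
    h := (fun t => θ.h t / deriv f t + deriv (deriv f) t / (θ.n * deriv f t ^ 2)) ∘ ψ
    g := (fun t => δ₁ ^ 2 / deriv f t * θ.g t) ∘ ψ
    n := θ.n
    isOpen_I := hI
    isConnected_I := hIc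
    smooth_h := ?_
    smooth_g := ?_
    g_ne_zero := ?_
    n_ne_zero := θ.n_ne_zero }, rfl, mapsTo_image f J, ?_, ?_⟩
  · exact ((((θ.smooth_h.mono hJI).div s1 hf0).add (s2.div (contDiffOn_const.mul (s1.pow 2))
      fun t ht => mul_ne_zero θ.n_ne_zero (pow_ne_zero 2 (hf0 t ht))))).comp hψ hψJ
  · exact ((contDiffOn_const.div s1 hf0).mul (θ.smooth_g.mono hJI)).comp hψ hψJ
  · intro t ht
    have := hψJ ht
    exact mul_ne_zero (div_ne_zero (pow_ne_zero 2 (left_ne_zero_of_mul (hpos _ this).ne'))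
      (hf0 _ this)) (θ.g_ne_zero _ (hJI this))
  · intro t ht
    simp only [Function.comp, hψf t ht]
  · intro t ht
    simp only [Function.comp, hψf t ht]

/-- The transformations with parameters `δ₁`, `δ₀` and `T` belong to the generalized equivalence
group of each subclass that is singled out by a condition on `n`. -/
theorem isGenEquivTransformation_of_eqOn {W : Set JointSpace} (hW : IsJointDomain W)
    {Φ : JointSpace → JointSpace} {δ₁ δ₀ : ℝ → ℝ} {T : ℝ → ℝ → ℝ}
    (hδ₁ : ContDiffOn ℝ ∞ δ₁ ((fun w : JointSpace => w.2.2.2) '' W))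
    (hδ₀ : ContDiffOn ℝ ∞ δ₀ ((fun w : JointSpace => w.2.2.2) '' W))
    (hT : ContDiffOn ℝ ∞ (Function.uncurry T) ((fun w : JointSpace => (w.2.2.2, w.1.1)) '' W))
    (hpos : ∀ w ∈ W, 0 < δ₁ w.2.2.2 * deriv (T w.2.2.2) w.1.1)
    (hΦ : EqOn Φ (burgersTransformation δ₁ δ₀ T) W) (P : ℝ → Prop) :
    IsGenEquivTransformation {θ : GenBurgers | P θ.n} Φ W := by
  set M := (fun w : JointSpace => (w.2.2.2, w.1.1)) '' W with hM
  have hMo : IsOpen M := isOpenMap_projNT W hW.isOpen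
  have hmem : ∀ w ∈ W, projNT w ∈ M := fun w hw => ⟨w, hw, rfl⟩
  -- the derivatives of `T` with respect to `t` as partial derivatives
  set Tu := Function.uncurry T with hTu
  have slice : ∀ (y : ℝ × ℝ), HasDerivAt (fun s : ℝ => ((y.1, s) : ℝ × ℝ)) (0, 1) y.2 := fun y =>
    (hasDerivAt_const _ _).prodMk (hasDerivAt_id _)
  have sT₁ := hT.pd hMo (0, 1)
  have sT₂ := sT₁.pd hMo (0, 1)
  have dT : ∀ y ∈ M, deriv (T y.1) y.2 = pd (0, 1) Tu y := fun y hy =>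
    (hasDerivAt_comp_curve (F := Tu) (γ := fun s : ℝ => (y.1, s))
      (hT.hasFDerivAt_of_isOpen hMo hy).differentiableAt (slice y)).deriv
  have nhd : ∀ y ∈ M, ∀ᶠ s in 𝓝 y.2, (y.1, s) ∈ M := fun y hy =>
    (slice y).continuousAt.eventually (hMo.mem_nhds hy)
  have ddT : ∀ y ∈ M, deriv (deriv (T y.1)) y.2 = pd (0, 1) (pd (0, 1) Tu) y := by
    intro y hy
    have e : deriv (T y.1) =ᶠ[𝓝 y.2] fun s => pd (0, 1) Tu (y.1, s) := by
      filter_upwards [nhd y hy] with s hs using dT (y.1, s) hs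
    rw [e.deriv_eq]
    exact (hasDerivAt_comp_curve (F := pd (0, 1) Tu) (γ := fun s : ℝ => (y.1, s))
      (sT₁.hasFDerivAt_of_isOpen hMo hy).differentiableAt (slice y)).deriv
  have hMpos : ∀ y ∈ M, 0 < δ₁ y.1 * pd (0, 1) Tu y := by
    intro y hy
    rw [← dT y hy]
    obtain ⟨w, hw, rfl⟩ := hy
    exact hpos w hw
  have hT0 : ∀ y ∈ M, pd (0, 1) Tu y ≠ 0 := fun y hy => right_ne_zero_of_mul (hMpos y hy).ne'
  have hδ0 : ∀ y ∈ M, δ₁ y.1 ≠ 0 := fun y hy => left_ne_zero_of_mul (hMpos y hy).ne'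
  have hbase : ∀ y ∈ M, 0 < δ₁ y.1 / pd (0, 1) Tu y := by
    intro y hy
    have h1 := hMpos y hy
    have h2 := hT0 y hy
    have : δ₁ y.1 / pd (0, 1) Tu y = δ₁ y.1 * pd (0, 1) Tu y / pd (0, 1) Tu y ^ 2 := by field_simp
    rw [this]
    positivity
  have hn0 : ∀ y ∈ M, y.1 ≠ 0 := by
    rintro _ ⟨w, hw, rfl⟩
    exact hW.n_ne_zero w hw
  have hfst : MapsTo Prod.fst M ((fun w : JointSpace => w.2.2.2) '' W) := by
    rintro _ ⟨w, hw, rfl⟩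
    exact ⟨w, hw, rfl⟩
  have sδ₁ : ContDiffOn ℝ ∞ (fun y : ℝ × ℝ => δ₁ y.1) M := hδ₁.comp contDiff_fst.contDiffOn hfst
  have sδ₀ : ContDiffOn ℝ ∞ (fun y : ℝ × ℝ => δ₀ y.1) M := hδ₀.comp contDiff_fst.contDiffOn hfst
  have sc : ContDiffOn ℝ ∞ (fun y : ℝ × ℝ => (δ₁ y.1 / pd (0, 1) Tu y) ^ (1 / y.1)) M :=
    (sδ₁.div sT₁ hT0).rpow (contDiffOn_const.div contDiff_fst.contDiffOn hn0)
      fun y hy => (hbase y hy).ne'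
  have sa : ContDiffOn ℝ ∞ (fun y : ℝ × ℝ => 1 / pd (0, 1) Tu y) M := contDiffOn_const.div sT₁ hT0
  have sb : ContDiffOn ℝ ∞ (fun y : ℝ × ℝ => pd (0, 1) (pd (0, 1) Tu) y
      / (y.1 * pd (0, 1) Tu y ^ 2)) M :=
    sT₂.div (contDiff_fst.contDiffOn.mul (sT₁.pow 2))
      fun y hy => mul_ne_zero (hn0 y hy) (pow_ne_zero 2 (hT0 y hy))
  have se : ContDiffOn ℝ ∞ (fun y : ℝ × ℝ => δ₁ y.1 ^ 2 / pd (0, 1) Tu y) M :=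
    (sδ₁.pow 2).div sT₁ hT0
  have hform : EqOn Φ (fun w => ((Tu (projNT w), δ₁ (projNT w).1 * w.1.2.1 + δ₀ (projNT w).1,
      (δ₁ (projNT w).1 / pd (0, 1) Tu (projNT w)) ^ (1 / (projNT w).1) * w.1.2.2),
      (1 / pd (0, 1) Tu (projNT w) * w.2.1 + pd (0, 1) (pd (0, 1) Tu) (projNT w)
        / ((projNT w).1 * pd (0, 1) Tu (projNT w) ^ 2),
      δ₁ (projNT w).1 ^ 2 / pd (0, 1) Tu (projNT w) * w.2.2.1, w.2.2.2))) W := by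
    intro w hw
    simp only
    rw [hΦ hw, ← dT _ (hmem w hw), ← ddT _ (hmem w hw), one_div_mul_eq_div]
    rfl
  refine ⟨hW, ?_, ?_, ?_⟩
  · refine ContDiffOn.congr ?_ hform
    have lift : ∀ {f : ℝ × ℝ → ℝ}, ContDiffOn ℝ ∞ f M →
        ContDiffOn ℝ ∞ (fun w => f (projNT w)) W := fun hf =>
      hf.comp projNT.contDiff.contDiffOn hmem
    exact ContDiffOn.prodMk ((lift hT).prodMk ((((lift sδ₁).mul (by fun_prop)).add
      (lift sδ₀)).prodMk ((lift sc).mul (by fun_prop)))) ((((lift sa).mul (by fun_prop)).add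
      (lift sb)).prodMk (((lift se).mul (by fun_prop)).prodMk (by fun_prop)))
  · intro w hw
    have hy := hmem w hw
    have dif : ∀ {f : ℝ × ℝ → ℝ}, ContDiffOn ℝ ∞ f M → DifferentiableAt ℝ f (projNT w) := fun hf =>
      (hf.hasFDerivAt_of_isOpen hMo hy).differentiableAt
    exact det_fderiv_ne_zero_of_fibered (dif hT) (dif sδ₁) (dif sδ₀) (dif sc) (dif sa) (dif sb)
      (dif se) (hT0 _ hy) (hδ0 _ hy) (Real.rpow_pos_of_pos (hbase _ hy) _).ne'
      (one_div_ne_zero (hT0 _ hy)) (div_ne_zero (pow_ne_zero 2 (hδ0 _ hy)) (hT0 _ hy))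
      (hform.eventuallyEq_of_mem (hW.isOpen.mem_nhds hw))
  · intro θ hθ D hD hDc hDb hDW
    have hJ : IsOpen (Prod.fst '' D) := isOpenMap_fst D hD
    have hJc : IsConnected (Prod.fst '' D) := hDc.image _ continuous_fst.continuousOn
    have hJM : ∀ t ∈ Prod.fst '' D, (θ.n, t) ∈ M := by
      rintro _ ⟨z, hz, rfl⟩
      exact ⟨_, hDW z hz, rfl⟩
    have hf : ContDiffOn ℝ ∞ (T θ.n) (Prod.fst '' D) :=
      hT.comp (f := fun t : ℝ => (θ.n, t)) (by fun_prop) hJM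
    have hp : ∀ t ∈ Prod.fst '' D, 0 < δ₁ θ.n * deriv (T θ.n) t := by
      rintro _ ⟨z, hz, rfl⟩
      exact hpos _ (hDW z hz)
    obtain ⟨θ', hn, hI, hh, hg⟩ := exists_target θ hJ hJc
      (by rintro _ ⟨z, hz, rfl⟩; exact (hDb hz).1) hf hp
    refine ⟨θ', by show P θ'.n; rw [hn]; exact hθ, mapsEquation_of_time hD hDc hDb hf hp hI hn hh hg
      (δ₀ := δ₀ θ.n) ?_, ?_⟩
    · intro z hz
      rw [hΦ (hDW z hz)]
      rfl
    · intro z hz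
      have ht : z.1 ∈ Prod.fst '' D := ⟨z, hz, rfl⟩
      rw [hΦ (hDW z hz)]
      change _ = (θ'.h (T θ.n z.1), θ'.g (T θ.n z.1), θ'.n)
      rw [hh _ ht, hg _ ht, hn]
      rfl

/-! ### Admissible transformations -/

theorem exists_antiderivative {I : Set ℝ} (hI : IsOpen I) (hIc : IsConnected I) {g : ℝ → ℝ}
    (hg : ContinuousOn g I) : ∃ G : ℝ → ℝ, ∀ t ∈ I, HasDerivAt G (g t) t := by
  obtain ⟨t₀, ht₀⟩ := hIc.nonempty
  refine ⟨fun t => ∫ s in t₀..t, g s, fun t ht => ?_⟩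
  have hsub : uIcc t₀ t ⊆ I := hIc.isPreconnected.ordConnected.uIcc_subset ht₀ ht
  exact intervalIntegral.integral_hasDerivAt_right (hg.mono hsub).intervalIntegrable
    (hg.stronglyMeasurableAtFilter hI t ht) (hg.continuousAt (hI.mem_nhds ht))

/-- The number `σ` represents the sign of `g`. -/
theorem constant_sign {I : Set ℝ} (hIc : IsConnected I) {g : ℝ → ℝ}
    (hg : ContinuousOn g I) (h0 : ∀ t ∈ I, g t ≠ 0) :
    ∃ σ : ℝ, σ ≠ 0 ∧ ∀ t ∈ I, 0 < σ * g t := by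
  obtain ⟨t₀, ht₀⟩ := hIc.nonempty
  refine ⟨g t₀, h0 t₀ ht₀, fun t ht => ?_⟩
  by_contra hle
  have hmem : (0 : ℝ) ∈ (fun t => g t₀ * g t) '' I := by
    refine hIc.isPreconnected.intermediate_value (f := fun t => g t₀ * g t) ht ht₀
      (continuousOn_const.mul hg) ⟨not_lt.1 hle, ?_⟩
    exact (mul_self_pos.2 (h0 t₀ ht₀)).le
  obtain ⟨s, hs, hs0⟩ := hmem
  exact mul_ne_zero (h0 t₀ ht₀) (h0 s hs) hs0

theorem IsConnected.const_of_pd_eq_zero {E : Type*} [NormedAddCommGroup E] [NormedSpace ℝ E]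
    {D : Set E} (hDc : IsConnected D) (hD : IsOpen D) {F : E → ℝ}
    (hF : ∀ z ∈ D, DifferentiableAt ℝ F z) (h : ∀ z ∈ D, ∀ v, pd v F z = 0) :
    ∃ c, ∀ z ∈ D, F z = c :=
  hD.exists_is_const_of_fderiv_eq_zero hDc.isPreconnected
    (fun z hz => (hF z hz).differentiableWithinAt)
    (fun z hz => by ext v; exact h z hz v)

theorem multiplier_eq {τ δ U u n : ℝ} (hτ : τ ≠ 0) (hU : 0 < U) (hu : 0 < u) (hn : n ≠ 0)
    (h : τ * U ^ n = δ * u ^ n) : 0 < δ * τ ∧ U = (δ / τ) ^ (1 / n) * u := by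
  have hUn := Real.rpow_pos_of_pos hU n
  have hun := Real.rpow_pos_of_pos hu n
  have hδ : δ = τ * (U ^ n / u ^ n) := by
    field_simp
    exact h.symm
  have hq : δ / τ = (U / u) ^ n := by
    rw [Real.div_rpow hU.le hu.le, div_eq_iff hτ, mul_comm]
    exact hδ
  constructor
  · rw [hδ, mul_right_comm]
    exact mul_pos (mul_self_pos.2 hτ) (div_pos hUn hun)
  · rw [hq, ← Real.rpow_mul (div_pos hU hu).le, mul_one_div_cancel hn, Real.rpow_one,
      div_mul_cancel₀ _ hu.ne']

section Induced

variable {θ θ' : GenBurgers} {φ : VarSpace → VarSpace} {D : Set VarSpace}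

/-- On a possibly nonconvex domain, the local dependence of `T` on `t` only is not sufficient for
a global one. The relation `g'(T) T_t = δ₁² g` means that the difference of the antiderivatives of
`g'` at `T` and of `δ₁² g` at `t` is constant on the connected domain, which determines `T`. -/
theorem MapsEquation.time_eq_of_fst_eq (H : MapsEquation θ θ' φ D) {δ₁ : ℝ}
    (hδ : ∀ z ∈ D, ∂ₓ (fun z => (φ z).2.1) z = δ₁) {y z : VarSpace} (hy : y ∈ D) (hz : z ∈ D)
    (hyz : y.1 = z.1) : (φ y).1 = (φ z).1 := by
  have hD := H.isPoint.isOpen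
  obtain ⟨G, hG⟩ := exists_antiderivative θ.isOpen_I θ.isConnected_I θ.smooth_g.continuousOn
  obtain ⟨G', hG'⟩ := exists_antiderivative θ'.isOpen_I θ'.isConnected_I θ'.smooth_g.continuousOn
  have hinj : InjOn G' θ'.I :=
    injOn_of_deriv_ne_zero θ'.isConnected_I.isPreconnected.ordConnected hG' θ'.g_ne_zero
  have hder : ∀ w ∈ D, HasFDerivAt (fun w => G' (φ w).1 - δ₁ ^ 2 * G w.1)
      (θ'.g (φ w).1 • fderiv ℝ (fun z => (φ z).1) w
        - δ₁ ^ 2 • (θ.g w.1 • ContinuousLinearMap.fst ℝ ℝ (ℝ × ℝ))) w := by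
    intro w hw
    exact ((hG' _ (H.target hw).1).comp_hasFDerivAt w
      (H.contDiffOn_fst.hasFDerivAt_of_isOpen hD hw)).sub
      (((hG _ (H.source hw).1).comp_hasFDerivAt w hasFDerivAt_fst).const_mul _)
  obtain ⟨c, hc⟩ := H.isPoint.isConnected.const_of_pd_eq_zero hD
    (fun w hw => (hder w hw).differentiableAt) (by
      rintro w hw ⟨v₁, v₂, v₃⟩
      have h1 := (H.pd_space hw).2.2.2
      have h2 := pd_varSpace (fun z => (φ z).1) w v₁ v₂ v₃
      rw [(H.pd_time_eq_zero hw).1, (H.pd_time_eq_zero hw).2] at h2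
      have h3 : fderiv ℝ (fun z => (φ z).1) w (v₁, v₂, v₃) = v₁ * ∂ₜ (fun z => (φ z).1) w :=
        h2.trans (by ring)
      rw [hδ w hw] at h1
      rw [(hder w hw).pd_eq]
      simp only [_root_.sub_apply, _root_.smul_apply, h3, smul_eq_mul, ContinuousLinearMap.coe_fst']
      linear_combination -v₁ * h1)
  refine hinj (H.target hy).1 (H.target hz).1 ?_
  have e1 := hc y hy
  have e2 := hc z hz
  simp only [hyz] at e1
  linarith

/-- Each admissible transformation with `n ≠ 1` is induced by a transformation whose parameters do
not depend on `n`, and which is an equivalence transformation of each subclass that is singled out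
by a condition on `n`. -/
theorem MapsEquation.exists_parameters (H : MapsEquation θ θ' φ D) (hn : θ.n ≠ 1) :
    ∃ (δ₁ δ₀ : ℝ) (T : ℝ → ℝ) (W : Set JointSpace),
      ContDiffOn ℝ ∞ T (Prod.fst '' D) ∧ (∀ t ∈ Prod.fst '' D, 0 < δ₁ * deriv T t) ∧
      (∀ P : ℝ → Prop, IsGenEquivTransformation {θ : GenBurgers | P θ.n}
        (burgersTransformation (fun _ => δ₁) (fun _ => δ₀) (fun _ => T)) W) ∧
      Induces (burgersTransformation (fun _ => δ₁) (fun _ => δ₀) (fun _ => T)) W θ θ' φ D := by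
  have hD := H.isPoint.isOpen
  have hDc := H.isPoint.isConnected
  have dif : ∀ {F : VarSpace → ℝ}, ContDiffOn ℝ ∞ F D → ∀ y ∈ D, DifferentiableAt ℝ F y :=
    fun hF y hy => (hF.hasFDerivAt_of_isOpen hD hy).differentiableAt
  have sX := H.contDiffOn_snd_fst
  obtain ⟨δ₁, hδ₁⟩ := hDc.const_of_pd_eq_zero hD (dif (sX.pd hD (0, 1, 0)))
    fun z hz => (H.determined hn hz).2.2.1
  have dX₁ : ∀ z : VarSpace, HasFDerivAt (fun z : VarSpace => δ₁ * z.2.1) _ z := fun z =>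
    ((hasFDerivAt_snd (𝕜 := ℝ) (p := z)).fst.const_mul δ₁)
  obtain ⟨δ₀, hδ₀⟩ := hDc.const_of_pd_eq_zero hD (F := fun z => (φ z).2.1 - δ₁ * z.2.1)
    (fun z hz => (dif sX z hz).sub (dX₁ z).differentiableAt) (by
      rintro z hz ⟨v₁, v₂, v₃⟩
      refine (((dif sX z hz).hasFDerivAt.sub (dX₁ z)).pd_eq _).trans ?_
      have h2 := pd_varSpace (fun z => (φ z).2.1) z v₁ v₂ v₃
      rw [(H.determined hn hz).2.1, hδ₁ z hz, (H.pd_space hz).1] at h2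
      have h3 : fderiv ℝ (fun z => (φ z).2.1) z (v₁, v₂, v₃) = v₂ * δ₁ := h2.trans (by ring)
      simp [h3]
      ring)
  -- `T` as a function of `t`
  classical
  let T : ℝ → ℝ := fun t => if h : ∃ z ∈ D, z.1 = t then (φ h.choose).1 else 0
  have hT : ∀ z ∈ D, T z.1 = (φ z).1 := by
    intro z hz
    have h : ∃ y ∈ D, y.1 = z.1 := ⟨z, hz, rfl⟩
    simp only [T, dif_pos h]
    exact H.time_eq_of_fst_eq hδ₁ h.choose_spec.1 hz h.choose_spec.2
  have slice : ∀ z : VarSpace, ∀ s, HasDerivAt (fun s : ℝ => ((s, z.2) : VarSpace)) (1, 0) s :=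
    fun z s => (hasDerivAt_id _).prodMk (hasDerivAt_const _ _)
  have nhd : ∀ z ∈ D, ∀ᶠ s in 𝓝 z.1, ((s, z.2) : VarSpace) ∈ D := fun z hz =>
    (slice z z.1).continuousAt.eventually (hD.mem_nhds hz)
  have evT : ∀ z ∈ D, T =ᶠ[𝓝 z.1] fun s => (φ (s, z.2)).1 := fun z hz => by
    filter_upwards [nhd z hz] with s hs using hT _ hs
  have sT : ContDiffOn ℝ ∞ T (Prod.fst '' D) := by
    rintro _ ⟨z, hz, rfl⟩
    have h1 : ContDiffAt ℝ ∞ (fun z => (φ z).1) (z.1, z.2) :=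
      H.contDiffOn_fst.contDiffAt (hD.mem_nhds hz)
    have h2 : ContDiffAt ℝ ∞ (fun s : ℝ => ((s, z.2) : VarSpace)) z.1 := by fun_prop
    exact ((h1.comp z.1 h2).congr_of_eventuallyEq (evT z hz)).contDiffWithinAt
  have dT : ∀ z ∈ D, deriv T z.1 = ∂ₜ (fun z => (φ z).1) z := by
    intro z hz
    rw [(evT z hz).deriv_eq]
    exact (hasDerivAt_comp_curve (F := fun z => (φ z).1) (γ := fun s : ℝ => ((s, z.2) : VarSpace))
      (dif H.contDiffOn_fst z hz) (slice z z.1)).deriv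
  have ddT : ∀ z ∈ D, deriv (deriv T) z.1 = ∂ₜ (∂ₜ fun z => (φ z).1) z := by
    intro z hz
    have e : deriv T =ᶠ[𝓝 z.1] fun s => ∂ₜ (fun z => (φ z).1) (s, z.2) := by
      filter_upwards [nhd z hz] with s hs using dT _ hs
    rw [e.deriv_eq]
    exact (hasDerivAt_comp_curve (F := ∂ₜ fun z => (φ z).1)
      (γ := fun s : ℝ => ((s, z.2) : VarSpace))
      (dif (H.contDiffOn_fst.pd hD _) z hz) (slice z z.1)).deriv
  have hposU : ∀ z ∈ D, 0 < δ₁ * ∂ₜ (fun z => (φ z).1) z ∧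
      (φ z).2.2 = (δ₁ / ∂ₜ (fun z => (φ z).1) z) ^ (1 / θ.n) * z.2.2 := by
    intro z hz
    have h1 := (H.determined hn hz).2.2.2.1
    have hτ := H.dt_fst_ne_zero hz
    have hU := (H.target hz).2
    have hu := (H.source hz).2
    rw [hδ₁ z hz] at h1
    exact multiplier_eq hτ hU hu θ.n_ne_zero h1
  have hpos : ∀ t ∈ Prod.fst '' D, 0 < δ₁ * deriv T t := by
    rintro _ ⟨z, hz, rfl⟩
    rw [dT z hz]
    exact (hposU z hz).1
  -- the joint domain: `t` in the projection of `D`, and the signs of `g` and `n` are fixed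
  obtain ⟨σ, hσ, hσg⟩ := constant_sign θ.isConnected_I θ.smooth_g.continuousOn θ.g_ne_zero
  have hJc : Convex ℝ (Prod.fst '' D) :=
    (hDc.image _ continuous_fst.continuousOn).isPreconnected.ordConnected.convex
  have hJo : IsOpen (Prod.fst '' D) := isOpenMap_fst D hD
  let W : Set JointSpace := ((Prod.fst '' D) ×ˢ (univ ×ˢ Ioi 0)) ×ˢ
    (univ ×ˢ ({g | 0 < σ * g} ×ˢ {n | 0 < θ.n * n}))
  have hhalf : ∀ a : ℝ, Convex ℝ {s : ℝ | 0 < a * s} := fun a =>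
    convex_halfSpace_gt (IsLinearMap.isLinearMap_smul a) 0
  have hhalfo : ∀ a : ℝ, IsOpen {s : ℝ | 0 < a * s} := fun a =>
    isOpen_lt continuous_const (by fun_prop)
  have hDW : ∀ z ∈ D, (z, θ.val z.1) ∈ W := fun z hz =>
    ⟨⟨⟨z, hz, rfl⟩, trivial, (H.source hz).2⟩, trivial, hσg _ (H.source hz).1,
      mul_self_pos.2 θ.n_ne_zero⟩
  have hW : IsJointDomain W :=
    { isOpen := (hJo.prod (isOpen_univ.prod isOpen_Ioi)).prod
        (isOpen_univ.prod ((hhalfo σ).prod (hhalfo θ.n)))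
      convex := (hJc.prod (convex_univ.prod (convex_Ioi 0))).prod
        (convex_univ.prod ((hhalf σ).prod (hhalf θ.n)))
      nonempty := by
        obtain ⟨z, hz⟩ := hDc.nonempty
        exact ⟨_, hDW z hz⟩
      u_pos := fun w hw => hw.1.2.2
      g_ne_zero := fun w hw => right_ne_zero_of_mul (ne_of_gt hw.2.2.1)
      n_ne_zero := fun w hw => right_ne_zero_of_mul (ne_of_gt hw.2.2.2) }
  refine ⟨δ₁, δ₀, T, W, sT, hpos, fun P => isGenEquivTransformation_of_eqOn hW contDiffOn_const
    contDiffOn_const ?_ (fun w hw => hpos _ hw.1.1) (fun w _ => rfl) P, ?_⟩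
  · refine sT.comp contDiff_snd.contDiffOn ?_
    rintro _ ⟨w, hw, rfl⟩
    exact hw.1.1
  · intro z hz
    refine ⟨hDW z hz, ?_⟩
    obtain ⟨hn', -, -, -, hh⟩ := H.determined hn hz
    have hg := (H.pd_space hz).2.2.2
    have hτ := H.dt_fst_ne_zero hz
    rw [hδ₁ z hz] at hg
    have e1 : burgersTransformation (fun _ => δ₁) (fun _ => δ₀) (fun _ => T) (z, θ.val z.1)
        = ((T z.1, δ₁ * z.2.1 + δ₀, (δ₁ / deriv T z.1) ^ (1 / θ.n) * z.2.2),
          (θ.h z.1 / deriv T z.1 + deriv (deriv T) z.1 / (θ.n * deriv T z.1 ^ 2),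
          δ₁ ^ 2 / deriv T z.1 * θ.g z.1, θ.n)) := rfl
    have e2 : θ'.g (φ z).1 = δ₁ ^ 2 / ∂ₜ (fun z => (φ z).1) z * θ.g z.1 := by
      field_simp
      linear_combination -hg
    have e3 : δ₁ * z.2.1 + δ₀ = (φ z).2.1 := by
      have := hδ₀ z hz
      linarith
    rw [e1, dT z hz, ddT z hz, hT z hz, ← (hposU z hz).2, ← hh, ← e2, e3, ← hn']
    rfl

end Induced

/-! ### The generalized equivalence group -/

/-- A smooth function on an open convex set whose derivative vanishes on the kernel of a
projection `π` is a smooth function of the image under `π`. -/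
theorem exists_factor {E E' : Type*} [NormedAddCommGroup E] [NormedSpace ℝ E]
    [NormedAddCommGroup E'] [NormedSpace ℝ E'] (π : E →L[ℝ] E') (σ : E' →L[ℝ] E)
    (hσ : ∀ y, π (σ y) = y) {W : Set E} (hW : IsOpen W) (hWc : Convex ℝ W) {F : E → ℝ}
    (hF : ContDiffOn ℝ ∞ F W) (hker : ∀ w ∈ W, ∀ v, π v = 0 → pd v F w = 0) :
    ∃ f : E' → ℝ, ContDiffOn ℝ ∞ f (π '' W) ∧ ∀ w ∈ W, f (π w) = F w := by
  classical
  have hconst : ∀ a ∈ W, ∀ b ∈ W, π a = π b → F a = F b := by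
    intro a ha b hb hab
    have hseg : ∀ s ∈ Icc (0 : ℝ) 1, a + s • (b - a) ∈ W := fun s hs =>
      hWc.add_smul_sub_mem ha hb hs
    have hl : ∀ s : ℝ, HasDerivAt (fun s : ℝ => a + s • (b - a)) (b - a) s := by
      intro s
      simpa using ((hasDerivAt_id s).smul_const (b - a)).const_add a
    have hd : ∀ s ∈ Icc (0 : ℝ) 1, HasDerivAt (fun s : ℝ => F (a + s • (b - a))) 0 s := by
      intro s hs
      have h1 := hasDerivAt_comp_curve (F := F)
        (hF.hasFDerivAt_of_isOpen hW (hseg s hs)).differentiableAt (hl s)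
      have h2 : fderiv ℝ F (a + s • (b - a)) (b - a) = 0 :=
        hker _ (hseg s hs) (b - a) (by rw [map_sub, hab, sub_self])
      rwa [h2] at h1
    have := constant_of_has_deriv_right_zero
      (fun s hs => (hd s hs).continuousAt.continuousWithinAt)
      (fun s hs => (hd s (Ico_subset_Icc_self hs)).hasDerivWithinAt) 1 (right_mem_Icc.2 zero_le_one)
    simpa using this.symm
  let f : E' → ℝ := fun y => if h : ∃ w ∈ W, π w = y then F h.choose else 0
  have hf : ∀ w ∈ W, f (π w) = F w := by
    intro w hw
    have h : ∃ y ∈ W, π y = π w := ⟨w, hw, rfl⟩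
    simp only [f, dif_pos h]
    exact hconst _ h.choose_spec.1 _ hw h.choose_spec.2
  refine ⟨f, ?_, hf⟩
  rintro _ ⟨w, hw, rfl⟩
  have hs : ContDiff ℝ ∞ fun y : E' => w + σ (y - π w) := by fun_prop
  have hs0 : w + σ (π w - π w) = w := by simp
  have hev : f =ᶠ[𝓝 (π w)] fun y => F (w + σ (y - π w)) := by
    have hmem : ∀ᶠ y in 𝓝 (π w), w + σ (y - π w) ∈ W := by
      refine hs.continuous.continuousAt.eventually_mem ?_
      rw [hs0]
      exact hW.mem_nhds hw
    filter_upwards [hmem] with y hy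
    rw [← hf _ hy, map_add, hσ, add_sub_cancel]
  have hFw : ContDiffAt ℝ ∞ F (w + σ (π w - π w)) := by
    rw [hs0]
    exact hF.contDiffAt (hW.mem_nhds hw)
  exact ((hFw.comp (π w) hs.contDiffAt).congr_of_eventuallyEq hev).contDiffWithinAt

/-- The insertion of the arbitrary elements `h = h₀ + h₁ (t - t₀)`, `g = g₀ + g₁ (t - t₀)` and `n`
of an equation of the class. -/
def insertAffine (w : JointSpace) (h₁ g₁ : ℝ) (z : VarSpace) : JointSpace :=
  (z, (w.2.1 + h₁ * (z.1 - w.1.1), w.2.2.1 + g₁ * (z.1 - w.1.1), w.2.2.2))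

theorem insertAffine_self (w : JointSpace) (h₁ g₁ : ℝ) : insertAffine w h₁ g₁ w.1 = w := by
  simp [insertAffine]

theorem hasFDerivAt_insertAffine (w : JointSpace) (h₁ g₁ : ℝ) (z : VarSpace) :
    ∃ L : VarSpace →L[ℝ] JointSpace, HasFDerivAt (insertAffine w h₁ g₁) L z ∧
      ∀ v, L v = (v, (h₁ * v.1, g₁ * v.1, 0)) := by
  have d1 := (hasFDerivAt_fst (𝕜 := ℝ) (p := z)).sub_const w.1.1
  exact ⟨_, (hasFDerivAt_id z).prodMk (((d1.const_mul h₁).const_add w.2.1).prodMk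
    (((d1.const_mul g₁).const_add w.2.2.1).prodMk (hasFDerivAt_const w.2.2.2 z))), fun v => rfl⟩

theorem pd_comp_insertAffine {W : Set JointSpace} (hW : IsOpen W) {F : JointSpace → ℝ}
    (hF : ContDiffOn ℝ ∞ F W) (w : JointSpace) (h₁ g₁ : ℝ) {z : VarSpace}
    (hz : insertAffine w h₁ g₁ z ∈ W) (v : VarSpace) :
    pd v (fun z => F (insertAffine w h₁ g₁ z)) z
      = pd (v, (h₁ * v.1, g₁ * v.1, 0)) F (insertAffine w h₁ g₁ z) := by
  obtain ⟨L, hL, hLv⟩ := hasFDerivAt_insertAffine w h₁ g₁ z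
  rw [pd_comp hL (hF.hasFDerivAt_of_isOpen hW hz).differentiableAt, hLv]

theorem pd_pd_comp_insertAffine {W : Set JointSpace} (hW : IsOpen W) {F : JointSpace → ℝ}
    (hF : ContDiffOn ℝ ∞ F W) {w : JointSpace} {h₁ g₁ : ℝ} {D : Set VarSpace} (hD : IsOpen D)
    (hDW : MapsTo (insertAffine w h₁ g₁) D W) {z : VarSpace} (hz : z ∈ D) (v v' : VarSpace) :
    pd v (pd v' fun z => F (insertAffine w h₁ g₁ z)) z
      = pd (v, (h₁ * v.1, g₁ * v.1, 0)) (pd (v', (h₁ * v'.1, g₁ * v'.1, 0)) F)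
        (insertAffine w h₁ g₁ z) := by
  rw [← pd_comp_insertAffine hW (hF.pd hW _) w h₁ g₁ (hDW hz)]
  exact pd_eqOn hD (fun y hy => pd_comp_insertAffine hW hF w h₁ g₁ (hDW hy) v') v hz

section Group

variable {W : Set JointSpace} {Φ : JointSpace → JointSpace}

/-- Near each point `w` of the domain, the transformation acts on an equation with affine
coefficients whose values at `w` are the components of `w`. The slopes `h₁` and `g₁` are arbitrary. -/
theorem IsGenEquivTransformation.exists_mapsEquation
    (H : IsGenEquivTransformation Set.univ Φ W) {w : JointSpace} (hw : w ∈ W) (h₁ g₁ : ℝ) :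
    ∃ (θ θ' : GenBurgers) (D : Set VarSpace), w.1 ∈ D ∧ IsOpen D ∧ θ.val w.1.1 = w.2 ∧
      MapsTo (insertAffine w h₁ g₁) D W ∧
      MapsEquation θ θ' (fun z => (Φ (insertAffine w h₁ g₁ z)).1) D ∧
      (Φ w).2 = θ'.val (Φ w).1.1 := by
  have hc : Continuous (insertAffine w h₁ g₁) := by
    unfold insertAffine
    fun_prop
  have hmem : insertAffine w h₁ g₁ ⁻¹' W ∈ 𝓝 w.1 := by
    refine hc.continuousAt.preimage_mem_nhds ?_
    rw [insertAffine_self]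
    exact H.domain.isOpen.mem_nhds hw
  obtain ⟨r, hr, hball⟩ := Metric.mem_nhds_iff.1 hmem
  let θ : GenBurgers :=
    { I := Metric.ball w.1.1 r
      h := fun t => w.2.1 + h₁ * (t - w.1.1)
      g := fun t => w.2.2.1 + g₁ * (t - w.1.1)
      n := w.2.2.2
      isOpen_I := Metric.isOpen_ball
      isConnected_I := ((convex_ball _ _).isConnected (Metric.nonempty_ball.2 hr))
      smooth_h := by fun_prop
      smooth_g := by fun_prop
      g_ne_zero := by
        intro t ht
        have : (t, w.1.2) ∈ Metric.ball w.1 r := by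
          rw [Metric.mem_ball, Prod.dist_eq, dist_self]
          exact max_lt ht hr
        exact H.domain.g_ne_zero _ (hball this)
      n_ne_zero := H.domain.n_ne_zero w hw }
  have hDb : Metric.ball w.1 r ⊆ θ.base := by
    intro z hz
    refine ⟨?_, H.domain.u_pos _ (hball hz)⟩
    rw [Metric.mem_ball, Prod.dist_eq] at hz
    exact (le_max_left _ _).trans_lt hz
  obtain ⟨θ', -, hm, hval⟩ := H.maps θ (mem_univ θ) (Metric.ball w.1 r) Metric.isOpen_ball
    ((convex_ball _ _).isConnected (Metric.nonempty_ball.2 hr)) hDb (fun z hz => hball hz)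
  have hwθ : θ.val w.1.1 = w.2 := by simp [θ, GenBurgers.val]
  refine ⟨θ, θ', Metric.ball w.1 r, Metric.mem_ball_self hr, Metric.isOpen_ball, hwθ,
    fun z hz => hball hz, hm, ?_⟩
  have := hval w.1 (Metric.mem_ball_self hr)
  rwa [hwθ] at this

/-- Equalities of continuous functions extend from the part `n ≠ 1` of the domain. -/
theorem IsJointDomain.eqOn_of_ne_one (hW : IsJointDomain W) {F G : JointSpace → ℝ}
    (hF : ContinuousOn F W) (hG : ContinuousOn G W)
    (h : ∀ w ∈ W, w.2.2.2 ≠ 1 → F w = G w) : EqOn F G W := by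
  have hop : IsOpenMap fun w : JointSpace => w.2.2.2 :=
    isOpenMap_snd.comp (isOpenMap_snd.comp isOpenMap_snd)
  have hdense : Dense {w : JointSpace | w.2.2.2 ≠ 1} := (dense_compl_singleton (1 : ℝ)).preimage hop
  have hsub : W ⊆ closure (W ∩ {w : JointSpace | w.2.2.2 ≠ 1}) :=
    hdense.open_subset_closure_inter hW.isOpen
  exact EqOn.of_subset_closure (fun w hw => h w hw.1 hw.2) hF hG inter_subset_left hsub

theorem pd_jointSpace (F : JointSpace → ℝ) (w : JointSpace) (v : VarSpace) (a b c : ℝ) :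
    pd (v, (a, b, c)) F w = pd (v, 0) F w + a * pd (0, (1, 0, 0)) F w
      + b * pd (0, (0, 1, 0)) F w + c * pd (0, (0, 0, 1)) F w := by
  rw [← pd_smul_dir, ← pd_smul_dir, ← pd_smul_dir, ← pd_add_dir, ← pd_add_dir, ← pd_add_dir]
  simp

theorem pd_jointSpace_zero (F : JointSpace → ℝ) (w : JointSpace) (a b c : ℝ) :
    pd (((a, b, c) : VarSpace), (0 : ElemSpace)) F w = a * pd ((1, 0, 0), 0) F w
      + b * pd ((0, 1, 0), 0) F w + c * pd ((0, 0, 1), 0) F w := by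
  rw [← pd_smul_dir, ← pd_smul_dir, ← pd_smul_dir, ← pd_add_dir, ← pd_add_dir]
  simp

end Group

section GroupDetermined

variable {W : Set JointSpace} {Φ : JointSpace → JointSpace}

/-- The consequences of `MapsEquation.pd_time_eq_zero` and `MapsEquation.pd_space`, which hold for
all `n`. The transformed `g` does not depend on the inserted slopes `h₁` and `g₁`, hence neither
does the total derivative `T_t + h₁ T_h + g₁ T_g`. -/
theorem IsGenEquivTransformation.determined_of_all
    (H : IsGenEquivTransformation Set.univ Φ W) {w : JointSpace} (hw : w ∈ W) :
    (∀ x u h g : ℝ, pd ((0, x, u), (h, g, 0)) (fun w => (Φ w).1.1) w = 0) ∧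
    pd ((1, 0, 0), 0) (fun w => (Φ w).1.1) w ≠ 0 ∧
    pd ((0, 0, 1), 0) (fun w => (Φ w).1.2.1) w = 0 ∧
    (Φ w).2.2.1 * pd ((1, 0, 0), 0) (fun w => (Φ w).1.1) w
      = pd ((0, 1, 0), 0) (fun w => (Φ w).1.2.1) w ^ 2 * w.2.2.1 ∧
    0 < (Φ w).1.2.2 := by
  have hWo := H.domain.isOpen
  have sT : ContDiffOn ℝ ∞ (fun w => (Φ w).1.1) W := H.smooth.fst.fst
  have sX : ContDiffOn ℝ ∞ (fun w => (Φ w).1.2.1) W := H.smooth.fst.snd.fst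
  have key : ∀ h₁ g₁ : ℝ,
      pd ((0, 1, 0), 0) (fun w => (Φ w).1.1) w = 0 ∧ pd ((0, 0, 1), 0) (fun w => (Φ w).1.1) w = 0 ∧
      pd ((0, 0, 1), 0) (fun w => (Φ w).1.2.1) w = 0 ∧ (Φ w).2.2.1 ≠ 0 ∧
      pd ((1, 0, 0), (h₁, g₁, 0)) (fun w => (Φ w).1.1) w ≠ 0 ∧
      (Φ w).2.2.1 * pd ((1, 0, 0), (h₁, g₁, 0)) (fun w => (Φ w).1.1) w
        = pd ((0, 1, 0), 0) (fun w => (Φ w).1.2.1) w ^ 2 * w.2.2.1 ∧ 0 < (Φ w).1.2.2 := by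
    intro h₁ g₁
    obtain ⟨θ, θ', D, hz, hD, hθ, hDW, hm, hval⟩ := H.exists_mapsEquation hw h₁ g₁
    have hι := insertAffine_self w h₁ g₁
    have cT := pd_comp_insertAffine hWo sT w h₁ g₁ (hDW hz)
    have cX := pd_comp_insertAffine hWo sX w h₁ g₁ (hDW hz)
    obtain ⟨a1, a2⟩ := hm.pd_time_eq_zero hz
    have a3 := hm.dt_fst_ne_zero hz
    obtain ⟨a4, -, -, a5⟩ := hm.pd_space hz
    have a6 := (hm.target hz).2
    have a7 := θ'.g_ne_zero _ (hm.target hz).1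
    simp only [hι] at cT cX a5 a6 a7
    have hθg : θ.g w.1.1 = w.2.2.1 := congrArg (fun y => y.2.1) hθ
    have hθ'g : (Φ w).2.2.1 = θ'.g (Φ w).1.1 := congrArg (fun y => y.2.1) hval
    rw [cT] at a1 a2 a3 a5
    rw [cX] at a4 a5
    simp only [mul_zero, mul_one] at a1 a2 a3 a4 a5
    rw [hθg, ← hθ'g] at a5
    rw [← hθ'g] at a7
    exact ⟨a1, a2, a4, a7, a3, a5.symm, a6⟩
  obtain ⟨kx, ku, kXu, kg, kt, e0, kU⟩ := key 0 0
  obtain ⟨-, -, -, -, -, e1, -⟩ := key 1 0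
  obtain ⟨-, -, -, -, -, e2, -⟩ := key 0 1
  rw [pd_jointSpace] at e0 e1 e2 kt
  have kh : pd (0, (1, 0, 0)) (fun w => (Φ w).1.1) w = 0 := by
    refine mul_left_cancel₀ kg ?_
    linear_combination e1 - e0
  have kgg : pd (0, (0, 1, 0)) (fun w => (Φ w).1.1) w = 0 := by
    refine mul_left_cancel₀ kg ?_
    linear_combination e2 - e0
  simp only [zero_mul, add_zero] at e0 kt
  refine ⟨fun x u h g => ?_, kt, kXu, e0, kU⟩
  rw [pd_jointSpace, pd_jointSpace_zero, kx, ku, kh, kgg]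
  simp

/-- The consequences of `MapsEquation.determined`, split with respect to the inserted slopes `h₁`
and `g₁`. -/
theorem IsGenEquivTransformation.determined_of_ne_one
    (H : IsGenEquivTransformation Set.univ Φ W) {w : JointSpace} (hw : w ∈ W)
    (hn : w.2.2.2 ≠ 1) :
    (Φ w).2.2.2 = w.2.2.2 ∧
    pd ((1, 0, 0), 0) (fun w => (Φ w).1.2.1) w = 0 ∧
    pd (0, (1, 0, 0)) (fun w => (Φ w).1.2.1) w = 0 ∧
    pd (0, (0, 1, 0)) (fun w => (Φ w).1.2.1) w = 0 ∧
    (∀ v : VarSpace, pd (v, 0) (pd ((0, 1, 0), 0) fun w => (Φ w).1.2.1) w = 0) ∧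
    pd (0, (1, 0, 0)) (pd ((0, 1, 0), 0) fun w => (Φ w).1.2.1) w = 0 ∧
    pd (0, (0, 1, 0)) (pd ((0, 1, 0), 0) fun w => (Φ w).1.2.1) w = 0 ∧
    pd ((1, 0, 0), 0) (fun w => (Φ w).1.1) w * (Φ w).1.2.2 ^ w.2.2.2
      = pd ((0, 1, 0), 0) (fun w => (Φ w).1.2.1) w * w.1.2.2 ^ w.2.2.2 ∧
    (Φ w).2.1 = w.2.1 / pd ((1, 0, 0), 0) (fun w => (Φ w).1.1) w
      + pd ((1, 0, 0), 0) (pd ((1, 0, 0), 0) fun w => (Φ w).1.1) w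
        / (w.2.2.2 * pd ((1, 0, 0), 0) (fun w => (Φ w).1.1) w ^ 2) := by
  have hWo := H.domain.isOpen
  have sT : ContDiffOn ℝ ∞ (fun w => (Φ w).1.1) W := H.smooth.fst.fst
  have sX : ContDiffOn ℝ ∞ (fun w => (Φ w).1.2.1) W := H.smooth.fst.snd.fst
  have key : ∀ h₁ g₁ : ℝ, (Φ w).2.2.2 = w.2.2.2 ∧
      pd ((1, 0, 0), (h₁, g₁, 0)) (fun w => (Φ w).1.2.1) w = 0 ∧
      (∀ v : VarSpace, pd (v, (h₁ * v.1, g₁ * v.1, 0))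
        (pd ((0, 1, 0), 0) fun w => (Φ w).1.2.1) w = 0) ∧
      pd ((1, 0, 0), (h₁, g₁, 0)) (fun w => (Φ w).1.1) w * (Φ w).1.2.2 ^ w.2.2.2
        = pd ((0, 1, 0), 0) (fun w => (Φ w).1.2.1) w * w.1.2.2 ^ w.2.2.2 ∧
      (Φ w).2.1 = w.2.1 / pd ((1, 0, 0), (h₁, g₁, 0)) (fun w => (Φ w).1.1) w
        + pd ((1, 0, 0), (h₁, g₁, 0)) (pd ((1, 0, 0), (h₁, g₁, 0)) fun w => (Φ w).1.1) w
          / (w.2.2.2 * pd ((1, 0, 0), (h₁, g₁, 0)) (fun w => (Φ w).1.1) w ^ 2) := by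
    intro h₁ g₁
    obtain ⟨θ, θ', D, hz, hD, hθ, hDW, hm, hval⟩ := H.exists_mapsEquation hw h₁ g₁
    have hι := insertAffine_self w h₁ g₁
    have cT := pd_comp_insertAffine hWo sT w h₁ g₁ (hDW hz)
    have cX := pd_comp_insertAffine hWo sX w h₁ g₁ (hDW hz)
    have ccT := pd_pd_comp_insertAffine hWo sT hD hDW hz
    have ccX := pd_pd_comp_insertAffine hWo sX hD hDW hz
    have hθh : θ.h w.1.1 = w.2.1 := congrArg (fun y => y.1) hθ
    have hθn : θ.n = w.2.2.2 := congrArg (fun y => y.2.2) hθ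
    have hθ'h : (Φ w).2.1 = θ'.h (Φ w).1.1 := congrArg (fun y => y.1) hval
    have hθ'n : (Φ w).2.2.2 = θ'.n := congrArg (fun y => y.2.2) hval
    obtain ⟨a1, a2, a3, a4, a5⟩ := hm.determined (by rw [hθn]; exact hn) hz
    simp only [hι] at cT cX ccT ccX a4 a5
    rw [cT, cX] at a4
    rw [cX] at a2
    rw [cT, ccT] at a5
    simp only [ccX] at a3
    simp only [mul_zero, mul_one] at a2 a3 a4 a5
    rw [hθn] at a1 a4 a5
    rw [hθh, ← hθ'h] at a5
    rw [← hθ'n] at a1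
    exact ⟨a1, a2, a3, a4, a5⟩
  obtain ⟨b1, b2, b3, b4, b5⟩ := key 0 0
  obtain ⟨-, c2, c3, -, -⟩ := key 1 0
  obtain ⟨-, d2, d3, -, -⟩ := key 0 1
  have hzero : ((0, 0, 0) : ElemSpace) = 0 := rfl
  simp only [zero_mul, hzero] at b2 b3 b4 b5
  have c3' := c3 (1, 0, 0)
  have d3' := d3 (1, 0, 0)
  rw [pd_jointSpace] at c2 d2 c3' d3'
  have b3' := b3 (1, 0, 0)
  refine ⟨b1, b2, ?_, ?_, b3, ?_, ?_, b4, b5⟩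
  · linear_combination c2 - b2
  · linear_combination d2 - b2
  · linear_combination c3' - b3'
  · linear_combination d3' - b3'

/-- The conclusions for `n ≠ 1` hold on the whole domain by continuity; that `T_t ≠ 0` and `U > 0`
also for `n = 1` keeps the quotients and the powers continuous. -/
theorem IsGenEquivTransformation.determined
    (H : IsGenEquivTransformation Set.univ Φ W) {w : JointSpace} (hw : w ∈ W) :
    (Φ w).2.2.2 = w.2.2.2 ∧
    (∀ t x u h g : ℝ, pd ((t, x, u), (h, g, 0)) (fun w => (Φ w).1.2.1) w
      = x * pd ((0, 1, 0), 0) (fun w => (Φ w).1.2.1) w) ∧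
    (∀ (v : VarSpace) (h g : ℝ), pd (v, (h, g, 0))
      (pd ((0, 1, 0), 0) fun w => (Φ w).1.2.1) w = 0) ∧
    pd ((1, 0, 0), 0) (fun w => (Φ w).1.1) w * (Φ w).1.2.2 ^ w.2.2.2
      = pd ((0, 1, 0), 0) (fun w => (Φ w).1.2.1) w * w.1.2.2 ^ w.2.2.2 ∧
    (Φ w).2.1 = w.2.1 / pd ((1, 0, 0), 0) (fun w => (Φ w).1.1) w
      + pd ((1, 0, 0), 0) (pd ((1, 0, 0), 0) fun w => (Φ w).1.1) w
        / (w.2.2.2 * pd ((1, 0, 0), 0) (fun w => (Φ w).1.1) w ^ 2) := by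
  have hWo := H.domain.isOpen
  have sT : ContDiffOn ℝ ∞ (fun w => (Φ w).1.1) W := H.smooth.fst.fst
  have sX : ContDiffOn ℝ ∞ (fun w => (Φ w).1.2.1) W := H.smooth.fst.snd.fst
  have sξ := sX.pd hWo ((0, 1, 0), 0)
  have sτ := sT.pd hWo ((1, 0, 0), 0)
  have sττ := sτ.pd hWo ((1, 0, 0), 0)
  have hn0 := H.domain.n_ne_zero
  have hu0 := H.domain.u_pos
  have hU0 : ∀ w ∈ W, 0 < (Φ w).1.2.2 := fun w hw => (H.determined_of_all hw).2.2.2.2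
  have hτ0 : ∀ w ∈ W, pd ((1, 0, 0), 0) (fun w => (Φ w).1.1) w ≠ 0 :=
    fun w hw => (H.determined_of_all hw).2.1
  have cn : ContinuousOn (fun w : JointSpace => w.2.2.2) W := by fun_prop
  have c1 : ContinuousOn (fun w => (Φ w).2.2.2) W := H.smooth.snd.snd.snd.continuousOn
  have cU : ContinuousOn (fun w => (Φ w).1.2.2) W := H.smooth.fst.snd.snd.continuousOn
  have ext : ∀ {F : JointSpace → ℝ}, ContinuousOn F W →
      (∀ w ∈ W, w.2.2.2 ≠ 1 → F w = 0) → F w = 0 := fun hF h =>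
    H.domain.eqOn_of_ne_one hF continuousOn_const h hw
  refine ⟨H.domain.eqOn_of_ne_one c1 cn (fun w hw hn => (H.determined_of_ne_one hw hn).1) hw,
    ?_, ?_, ?_, ?_⟩
  · intro t x u h g
    have e1 : pd ((1, 0, 0), 0) (fun w => (Φ w).1.2.1) w = 0 :=
      ext (sX.pd hWo _).continuousOn fun w hw hn => (H.determined_of_ne_one hw hn).2.1
    have e2 : pd (0, (1, 0, 0)) (fun w => (Φ w).1.2.1) w = 0 :=
      ext (sX.pd hWo _).continuousOn fun w hw hn => (H.determined_of_ne_one hw hn).2.2.1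
    have e3 : pd (0, (0, 1, 0)) (fun w => (Φ w).1.2.1) w = 0 :=
      ext (sX.pd hWo _).continuousOn fun w hw hn => (H.determined_of_ne_one hw hn).2.2.2.1
    rw [pd_jointSpace, pd_jointSpace_zero, e1, e2, e3, (H.determined_of_all hw).2.2.1]
    ring
  · intro v h g
    have e1 : pd (v, 0) (pd ((0, 1, 0), 0) fun w => (Φ w).1.2.1) w = 0 :=
      ext (sξ.pd hWo _).continuousOn fun w hw hn => (H.determined_of_ne_one hw hn).2.2.2.2.1 v
    have e2 : pd (0, (1, 0, 0)) (pd ((0, 1, 0), 0) fun w => (Φ w).1.2.1) w = 0 :=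
      ext (sξ.pd hWo _).continuousOn fun w hw hn => (H.determined_of_ne_one hw hn).2.2.2.2.2.1
    have e3 : pd (0, (0, 1, 0)) (pd ((0, 1, 0), 0) fun w => (Φ w).1.2.1) w = 0 :=
      ext (sξ.pd hWo _).continuousOn fun w hw hn => (H.determined_of_ne_one hw hn).2.2.2.2.2.2.1
    rw [pd_jointSpace, e1, e2, e3]
    ring
  · refine H.domain.eqOn_of_ne_one
      (F := fun w => pd ((1, 0, 0), 0) (fun w => (Φ w).1.1) w * (Φ w).1.2.2 ^ w.2.2.2)
      (G := fun w => pd ((0, 1, 0), 0) (fun w => (Φ w).1.2.1) w * w.1.2.2 ^ w.2.2.2)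
      (sτ.continuousOn.mul (cU.rpow cn fun w hw => Or.inl (hU0 w hw).ne'))
      (sξ.continuousOn.mul ((by fun_prop : ContinuousOn (fun w : JointSpace => w.1.2.2) W).rpow cn
        fun w hw => Or.inl (hu0 w hw).ne'))
      (fun w hw hn => (H.determined_of_ne_one hw hn).2.2.2.2.2.2.2.1) hw
  · refine H.domain.eqOn_of_ne_one (F := fun w => (Φ w).2.1)
      (G := fun w => w.2.1 / pd ((1, 0, 0), 0) (fun w => (Φ w).1.1) w
        + pd ((1, 0, 0), 0) (pd ((1, 0, 0), 0) fun w => (Φ w).1.1) w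
          / (w.2.2.2 * pd ((1, 0, 0), 0) (fun w => (Φ w).1.1) w ^ 2)) H.smooth.snd.fst.continuousOn
      (((by fun_prop : ContinuousOn (fun w : JointSpace => w.2.1) W).div sτ.continuousOn hτ0).add
        (sττ.continuousOn.div (cn.mul (sτ.continuousOn.pow 2))
          fun w hw => mul_ne_zero (hn0 w hw) (pow_ne_zero 2 (hτ0 w hw))))
      (fun w hw hn => (H.determined_of_ne_one hw hn).2.2.2.2.2.2.2.2) hw

/-- The projection of the joint space to `n`. -/
def projN : JointSpace →L[ℝ] ℝ := (ContinuousLinearMap.fst ℝ ℝ ℝ).comp projNT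

/-- The parameters of an equivalence transformation. They are `T`, `X_x` and `X - X_x x`, regarded as
functions on the projections of the domain. -/
theorem IsGenEquivTransformation.exists_parameters
    (H : IsGenEquivTransformation Set.univ Φ W) :
    ∃ (δ₁ δ₀ : ℝ → ℝ) (T : ℝ → ℝ → ℝ),
      ContDiffOn ℝ ∞ δ₁ ((fun w : JointSpace => w.2.2.2) '' W) ∧
      ContDiffOn ℝ ∞ δ₀ ((fun w : JointSpace => w.2.2.2) '' W) ∧
      ContDiffOn ℝ ∞ (Function.uncurry T) ((fun w : JointSpace => (w.2.2.2, w.1.1)) '' W) ∧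
      (∀ w ∈ W, 0 < δ₁ w.2.2.2 * deriv (T w.2.2.2) w.1.1) ∧
      Set.EqOn Φ (burgersTransformation δ₁ δ₀ T) W := by
  have hWo := H.domain.isOpen
  have hWc := H.domain.convex
  have sT : ContDiffOn ℝ ∞ (fun w => (Φ w).1.1) W := H.smooth.fst.fst
  have sX : ContDiffOn ℝ ∞ (fun w => (Φ w).1.2.1) W := H.smooth.fst.snd.fst
  have sξ := sX.pd hWo ((0, 1, 0), 0)
  let σ : ℝ × ℝ →L[ℝ] JointSpace :=
    ((ContinuousLinearMap.snd ℝ ℝ ℝ).prod (0 : ℝ × ℝ →L[ℝ] ℝ × ℝ)).prod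
      ((0 : ℝ × ℝ →L[ℝ] ℝ).prod ((0 : ℝ × ℝ →L[ℝ] ℝ).prod (ContinuousLinearMap.fst ℝ ℝ ℝ)))
  have hσ : ∀ y, projNT (σ y) = y := fun y => rfl
  let σ' : ℝ →L[ℝ] JointSpace := σ.comp ((ContinuousLinearMap.id ℝ ℝ).prod 0)
  have hσ' : ∀ y, projN (σ' y) = y := fun y => rfl
  obtain ⟨T, hTs, hT⟩ := exists_factor projNT σ hσ hWo hWc sT (by
    rintro w hw ⟨⟨t, x, u⟩, ⟨h, g, n⟩⟩ hv
    obtain ⟨rfl, rfl⟩ : n = 0 ∧ t = 0 := by simpa [Prod.ext_iff] using hv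
    exact (H.determined_of_all hw).1 x u h g)
  obtain ⟨δ₁, hδ₁s, hδ₁⟩ := exists_factor projN σ' hσ' hWo hWc sξ (by
    rintro w hw ⟨v, ⟨h, g, n⟩⟩ hv
    obtain rfl : n = 0 := hv
    exact (H.determined hw).2.2.1 v h g)
  have sx : ContDiffOn ℝ ∞ (fun w : JointSpace => w.1.2.1) W := by fun_prop
  obtain ⟨δ₀, hδ₀s, hδ₀⟩ := exists_factor projN σ' hσ' hWo hWc
    (F := fun w => (Φ w).1.2.1 - pd ((0, 1, 0), 0) (fun w => (Φ w).1.2.1) w * w.1.2.1)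
    (sX.sub (sξ.mul sx)) (by
    rintro w hw ⟨⟨t, x, u⟩, ⟨h, g, n⟩⟩ hv
    obtain rfl : n = 0 := hv
    have dX := sX.hasFDerivAt_of_isOpen hWo hw
    have dξ := sξ.hasFDerivAt_of_isOpen hWo hw
    have dx : HasFDerivAt (fun w : JointSpace => w.1.2.1) _ w :=
      (hasFDerivAt_fst (𝕜 := ℝ) (p := w)).snd.fst
    refine ((dX.sub (dξ.mul dx)).pd_eq _).trans ?_
    have e1 : fderiv ℝ (fun w => (Φ w).1.2.1) w ((t, x, u), (h, g, 0)) = _ :=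
      (H.determined hw).2.1 t x u h g
    have e2 : fderiv ℝ (pd ((0, 1, 0), 0) fun w => (Φ w).1.2.1) w ((t, x, u), (h, g, 0)) = 0 :=
      (H.determined hw).2.2.1 (t, x, u) h g
    simp [e1, e2]
    ring)
  have slice : ∀ (w : JointSpace) (s : ℝ),
      HasDerivAt (fun s : ℝ => (((s, w.1.2), w.2) : JointSpace)) ((1, 0, 0), 0) s := fun w s =>
    ((hasDerivAt_id _).prodMk (hasDerivAt_const _ _)).prodMk (hasDerivAt_const _ _)
  have nhd : ∀ w ∈ W, ∀ᶠ s in 𝓝 w.1.1, (((s, w.1.2), w.2) : JointSpace) ∈ W := fun w hw =>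
    (slice w w.1.1).continuousAt.eventually (hWo.mem_nhds hw)
  have dT : ∀ w ∈ W, deriv (fun s => T (w.2.2.2, s)) w.1.1
      = pd ((1, 0, 0), 0) (fun w => (Φ w).1.1) w := by
    intro w hw
    have e : (fun s => T (w.2.2.2, s)) =ᶠ[𝓝 w.1.1] fun s => (Φ ((s, w.1.2), w.2)).1.1 := by
      filter_upwards [nhd w hw] with s hs using hT _ hs
    rw [e.deriv_eq]
    exact (hasDerivAt_comp_curve (F := fun w => (Φ w).1.1)
      (γ := fun s : ℝ => (((s, w.1.2), w.2) : JointSpace))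
      (sT.hasFDerivAt_of_isOpen hWo hw).differentiableAt (slice w w.1.1)).deriv
  have ddT : ∀ w ∈ W, deriv (deriv fun s => T (w.2.2.2, s)) w.1.1
      = pd ((1, 0, 0), 0) (pd ((1, 0, 0), 0) fun w => (Φ w).1.1) w := by
    intro w hw
    have e : deriv (fun s => T (w.2.2.2, s)) =ᶠ[𝓝 w.1.1]
        fun s => pd ((1, 0, 0), 0) (fun w => (Φ w).1.1) ((s, w.1.2), w.2) := by
      filter_upwards [nhd w hw] with s hs using dT _ hs
    rw [e.deriv_eq]
    exact (hasDerivAt_comp_curve (F := pd ((1, 0, 0), 0) fun w => (Φ w).1.1)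
      (γ := fun s : ℝ => (((s, w.1.2), w.2) : JointSpace))
      ((sT.pd hWo _).hasFDerivAt_of_isOpen hWo hw).differentiableAt (slice w w.1.1)).deriv
  have hmul : ∀ w ∈ W, _ := fun w hw => multiplier_eq (H.determined_of_all hw).2.1
    (H.determined_of_all hw).2.2.2.2 (H.domain.u_pos w hw) (H.domain.n_ne_zero w hw)
    (H.determined hw).2.2.2.1
  refine ⟨δ₁, δ₀, fun n t => T (n, t), hδ₁s, hδ₀s, hTs, ?_, ?_⟩
  · intro w hw
    have h1 : δ₁ w.2.2.2 = _ := hδ₁ w hw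
    rw [h1]
    exact (dT w hw).symm ▸ (hmul w hw).1
  · intro w hw
    have h1 : δ₁ w.2.2.2 = _ := hδ₁ w hw
    have h2 : δ₀ w.2.2.2 = _ := hδ₀ w hw
    have h3 : T (w.2.2.2, w.1.1) = _ := hT w hw
    obtain ⟨b1, -, -, -, b2⟩ := H.determined hw
    obtain ⟨-, hτ, -, b3, -⟩ := H.determined_of_all hw
    change Φ w = ((T (w.2.2.2, w.1.1), δ₁ w.2.2.2 * w.1.2.1 + δ₀ w.2.2.2,
      (δ₁ w.2.2.2 / deriv (fun s => T (w.2.2.2, s)) w.1.1) ^ (1 / w.2.2.2) * w.1.2.2),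
      (w.2.1 / deriv (fun s => T (w.2.2.2, s)) w.1.1 +
        deriv (deriv fun s => T (w.2.2.2, s)) w.1.1
          / (w.2.2.2 * deriv (fun s => T (w.2.2.2, s)) w.1.1 ^ 2),
      δ₁ w.2.2.2 ^ 2 / deriv (fun s => T (w.2.2.2, s)) w.1.1 * w.2.2.1, w.2.2.2))
    rw [dT w hw, ddT w hw, h1, h2, h3, ← (hmul w hw).2, ← b2, add_sub_cancel]
    have e : pd ((0, 1, 0), 0) (fun w => (Φ w).1.2.1) w ^ 2
        / pd ((1, 0, 0), 0) (fun w => (Φ w).1.1) w * w.2.2.1 = (Φ w).2.2.1 := by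
      field_simp
      linear_combination -b3
    rw [e]
    exact Prod.ext rfl (Prod.ext rfl (Prod.ext rfl b1))

end GroupDetermined

theorem theorem1 :
    -- the generalized equivalence group of the whole class
    (∀ W : Set JointSpace, IsJointDomain W → ∀ Φ : JointSpace → JointSpace,
      (IsGenEquivTransformation Set.univ Φ W ↔
        ∃ (δ₁ δ₀ : ℝ → ℝ) (T : ℝ → ℝ → ℝ),
          ContDiffOn ℝ ∞ δ₁ ((fun w : JointSpace => w.2.2.2) '' W) ∧
          ContDiffOn ℝ ∞ δ₀ ((fun w : JointSpace => w.2.2.2) '' W) ∧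
          ContDiffOn ℝ ∞ (Function.uncurry T)
            ((fun w : JointSpace => (w.2.2.2, w.1.1)) '' W) ∧
          (∀ w ∈ W, 0 < δ₁ w.2.2.2 * deriv (T w.2.2.2) w.1.1) ∧
          Set.EqOn Φ (burgersTransformation δ₁ δ₀ T) W)) ∧
    -- its elements with parameters independent of `n` generate the groupoid of the subclass `n ≠ 1`
    (∀ (θ θ' : GenBurgers) (φ : VarSpace → VarSpace) (D : Set VarSpace),
      IsAdmissible {θ : GenBurgers | θ.n ≠ 1} θ θ' φ D →
        ∃ (δ₁ δ₀ : ℝ) (T : ℝ → ℝ) (W : Set JointSpace),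
          ContDiffOn ℝ ∞ T (Prod.fst '' D) ∧
          (∀ t ∈ Prod.fst '' D, 0 < δ₁ * deriv T t) ∧
          IsGenEquivTransformation Set.univ
            (burgersTransformation (fun _ => δ₁) (fun _ => δ₀) (fun _ => T)) W ∧
          Induces (burgersTransformation (fun _ => δ₁) (fun _ => δ₀) (fun _ => T)) W θ θ' φ D) ∧
    -- the subclass `n ≠ 1` is normalized in the generalized sense
    IsNormalizedGen {θ : GenBurgers | θ.n ≠ 1} := by
  have huniv : (Set.univ : Set GenBurgers) = {θ : GenBurgers | (fun _ => True) θ.n} := by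
    ext; simp
  refine ⟨fun W hW Φ => ⟨fun H => H.exists_parameters, ?_⟩, ?_, ?_⟩
  · rintro ⟨δ₁, δ₀, T, hδ₁, hδ₀, hT, hpos, hΦ⟩
    rw [huniv]
    exact isGenEquivTransformation_of_eqOn hW hδ₁ hδ₀ hT hpos hΦ fun _ => True
  · rintro θ θ' φ D ⟨hθ, -, H⟩
    obtain ⟨δ₁, δ₀, T, W, hT, hpos, hgen, hind⟩ := H.exists_parameters hθ
    exact ⟨δ₁, δ₀, T, W, hT, hpos, by rw [huniv]; exact hgen fun _ => True, hind⟩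
  · rintro θ θ' φ D ⟨hθ, -, H⟩
    obtain ⟨δ₁, δ₀, T, W, -, -, hgen, hind⟩ := H.exists_parameters hθ
    exact ⟨_, W, hgen fun n => n ≠ 1, hind⟩
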